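/- Let $n \ge 3$, let $R_8$ be the blow-up of $\mathbb{CP}^2$ at $8$ points in general position (no three on a line, no six on a conic, and no cubic through all eight points that is singular at one of them), and let $$M = R_8 \times \mathbb{CP}^1 \times \mathbb{CP}^{n-3},$$ with projections $\mathrm{pr}_1, \mathrm{pr}_2, \mathrm{pr}_3$ onto the three factors. Put $$[\omega] = \mathrm{pr}_1^* c_1(R_8) + \mathrm{pr}_2^* c_1(\mathbb{CP}^1) + n\, \mathrm{pr}_3^* c_1(\mathbb{CP}^{n-3}) \in H^2(M;\mathbb{Z}),$$ which is the class of any Kähler form $\omega = \omega_1 + \omega_2 + \omega_3$ on $M$ with $\omega_1 \in c_1(R_8)$, $\omega_2 \in c_1(\mathbb{CP}^1)$ and $\omega_3 \in n\, c_1(\mathbb{CP}^{n-3})$ pulled back from the factors. Let $P_M \to M$ be a principal $S^1$-bundle whose Euler class is $-[\omega]$. Then $P_M$ is simply connected. -/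

import Mathlib

open scoped Manifold ContDiff Matrix LinearAlgebra.Projectivization

namespace CircleBundle

noncomputable section

/-! ### Singular cohomology in degree two, with integer coefficients -/

/-- Singular `k`-simplices of `X`. -/
abbrev SingularSimplex (k : ℕ) (X : Type*) [TopologicalSpace X] :=
  C(stdSimplex ℝ (Fin (k + 1)), X)

/-- Integral singular `k`-cochains of `X`. -/
abbrev SingularCochain (k : ℕ) (X : Type*) [TopologicalSpace X] :=
  SingularSimplex k X → ℤ

section Cohomology

variable {X Y : Type*} [TopologicalSpace X] [TopologicalSpace Y]

/-- The `i`-th face (the one opposite to the `i`-th vertex) of a singular simplex. -/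
def face {k : ℕ} (i : Fin (k + 2)) (σ : SingularSimplex (k + 1) X) : SingularSimplex k X :=
  σ.comp ⟨stdSimplex.map i.succAbove, stdSimplex.continuous_map _⟩

/-- The singular coboundary `(δ c)(σ) = ∑ (-1)^i c(d_i σ)`. -/
def coboundary (k : ℕ) (X : Type*) [TopologicalSpace X] :
    SingularCochain k X →+ SingularCochain (k + 1) X where
  toFun c σ := ∑ i : Fin (k + 2), (-1) ^ (i : ℕ) * c (face i σ)
  map_zero' := by ext; simp
  map_add' a b := by ext; simp [mul_add, Finset.sum_add_distrib]

/-- Pull-back of singular cochains along a continuous map. -/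
def cochainMap (k : ℕ) (f : C(X, Y)) : SingularCochain k Y →+ SingularCochain k X where
  toFun c σ := c (f.comp σ)
  map_zero' := rfl
  map_add' _ _ := rfl

lemma coboundary_cochainMap (k : ℕ) (f : C(X, Y)) (c : SingularCochain k Y) :
    coboundary k X (cochainMap k f c) = cochainMap (k + 1) f (coboundary k Y c) := rfl

lemma coboundary_coboundary (c : SingularCochain 1 X) :
    coboundary 2 X (coboundary 1 X c) = 0 := by
  ext σ
  have key : ∀ (i j : Fin 4) (a b : Fin 3),
      i.succAbove ∘ a.succAbove = j.succAbove ∘ b.succAbove →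
      c (face a (face i σ)) = c (face b (face j σ)) := by
    intro i j a b h
    congr 1
    ext t
    change σ (stdSimplex.map i.succAbove (stdSimplex.map a.succAbove t)) =
      σ (stdSimplex.map j.succAbove (stdSimplex.map b.succAbove t))
    rw [stdSimplex.map_comp_apply, stdSimplex.map_comp_apply, h]
  change ∑ i : Fin 4, (-1) ^ (i : ℕ) * ∑ a : Fin 3, (-1) ^ (a : ℕ) * c (face a (face i σ)) = 0
  rw [Fin.sum_univ_four]
  simp only [Fin.sum_univ_three]
  rw [key 1 0 0 0 (by decide), key 2 0 0 1 (by decide), key 3 0 0 2 (by decide),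
    key 2 1 1 1 (by decide), key 3 1 1 2 (by decide), key 3 2 2 2 (by decide)]
  simp
  ring

/-- The integral singular cohomology group `H²(X; ℤ)`. -/
abbrev H2 (X : Type*) [TopologicalSpace X] : Type _ :=
  (coboundary 2 X).ker ⧸ ((coboundary 1 X).range.addSubgroupOf (coboundary 2 X).ker)

/-- The pull-back homomorphism `f^* : H²(Y; ℤ) → H²(X; ℤ)`. -/
def H2.map (f : C(X, Y)) : H2 Y →+ H2 X :=
  QuotientAddGroup.map _ _
    (((cochainMap 2 f).comp (coboundary 2 Y).ker.subtype).codRestrict (coboundary 2 X).ker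
      fun c => by
        have h : coboundary 2 Y c.1 = 0 := c.2
        change coboundary 2 X (cochainMap 2 f c.1) = 0
        rw [coboundary_cochainMap, h, map_zero])
    (by
      rintro c ⟨b, hb⟩
      refine ⟨cochainMap 1 f b, ?_⟩
      rw [coboundary_cochainMap, hb]
      rfl)

end Cohomology

/-! ### Principal circle bundles and their Euler class -/

section Euler

variable {P X : Type*} [TopologicalSpace P] [TopologicalSpace X] [MulAction Circle P]

/-- `π : P → X` is a (topological) principal `S¹`-bundle: around every point of `X` there is a
local trivialization that intertwines the action on `P` with the translation action on
`U × S¹`. -/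
structure IsPrincipalCircleBundle (π : P → X) : Prop where
  exists_trivialization : ∀ x : X, ∃ e : Bundle.Trivialization Circle π, x ∈ e.baseSet ∧
    ∀ y ∈ e.source, ∀ u : Circle, u • y ∈ e.source ∧ e (u • y) = ((e y).1, u * (e y).2)

/-- `c` is an obstruction cochain of the circle bundle `π : P → X`, that is the primary
obstruction to a section. It is computed from a section `s` over the points of `X` and an
extension `ℓ` of `s` over the singular `1`-simplices: the value of `c` on a singular `2`-simplex
`σ` is the winding number around `∂σ` of the section given by `ℓ`, measured in a
trivialization (a lift `τ`) of `P` over `σ`. Along the `i`-th face this section is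
`exp(2π√-1 fᵢ) • τ`, so that it turns by `fᵢ(v₁) - fᵢ(v₀)`, and `∂σ = ∑ (-1)^i d_i σ`. -/
def IsObstructionCochain (π : P → X) (c : SingularCochain 2 X) : Prop :=
  ∃ (s : X → P) (ℓ : SingularSimplex 1 X → SingularSimplex 1 P),
    (∀ x, π (s x) = x) ∧
    (∀ γ t, π (ℓ γ t) = γ t) ∧
    (∀ γ (j : Fin 2), ℓ γ (stdSimplex.vertex j) = s (γ (stdSimplex.vertex j))) ∧
    ∀ σ : SingularSimplex 2 X, ∃ (τ : SingularSimplex 2 P) (f : Fin 3 → SingularSimplex 1 ℝ),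
      (∀ t, π (τ t) = σ t) ∧
      (∀ i t, ℓ (face i σ) t = Circle.exp (2 * Real.pi * f i t) • face i τ t) ∧
      (c σ : ℝ) = ∑ i : Fin 3, (-1) ^ (i : ℕ) *
        (f i (stdSimplex.vertex 1) - f i (stdSimplex.vertex 0))

/-- `x ∈ H²(X; ℤ)` is the Euler class of the circle bundle `π : P → X`: it is the class of an
obstruction cocycle. -/
def IsEulerClass (π : P → X) (x : H2 X) : Prop :=
  ∃ c : (coboundary 2 X).ker, IsObstructionCochain π c.1 ∧ QuotientAddGroup.mk c = x

end Euler

/-! ### The first Chern class of a complex manifold -/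

section Chern

/-- `z / |z|` for `z ≠ 0`. -/
def phase (z : ℂ) : Circle := Circle.exp z.arg

lemma coe_phase {z : ℂ} (hz : z ≠ 0) : (phase z : ℂ) = z / ‖z‖ := by
  have h : (‖z‖ : ℂ) ≠ 0 := by simpa using hz
  rw [phase, Circle.coe_exp, eq_div_iff h, mul_comm, Complex.norm_mul_exp_arg_mul_I]

lemma phase_one : phase 1 = 1 := by simp [phase]

lemma phase_mul {z w : ℂ} (hz : z ≠ 0) (hw : w ≠ 0) : phase (z * w) = phase z * phase w := by
  apply Circle.ext
  rw [Circle.coe_mul, coe_phase hz, coe_phase hw, coe_phase (mul_ne_zero hz hw)]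
  simp
  ring

lemma continuousOn_phase : ContinuousOn phase {0}ᶜ := by
  have : ContinuousOn (fun z : ℂ => z / (‖z‖ : ℂ)) {0}ᶜ :=
    continuousOn_id.div (Complex.continuous_ofReal.comp continuous_norm).continuousOn
      (fun z hz => by simpa using hz)
  have hi : @Topology.IsInducing Circle ℂ _ _ (fun z => (z : ℂ)) := Topology.IsInducing.subtypeVal
  refine hi.continuousOn_iff.2 ?_
  exact this.congr fun z hz => coe_phase hz

variable {ι X E : Type*} [TopologicalSpace X] [NormedAddCommGroup E] [NormedSpace ℂ E]

lemma det_coordChange_mul (Z : VectorBundleCore ℂ X E ι) {i j k : ι} {x : X}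
    (hx : x ∈ Z.baseSet i ∩ Z.baseSet j ∩ Z.baseSet k) :
    (Z.coordChange j k x).det * (Z.coordChange i j x).det = (Z.coordChange i k x).det := by
  have h : (Z.coordChange j k x : E →ₗ[ℂ] E) ∘ₗ (Z.coordChange i j x : E →ₗ[ℂ] E) =
      (Z.coordChange i k x : E →ₗ[ℂ] E) :=
    LinearMap.ext fun v => Z.coordChange_comp i j k x hx v
  change LinearMap.det _ * LinearMap.det _ = LinearMap.det _
  rw [← LinearMap.det_comp, h]

lemma det_coordChange_self (Z : VectorBundleCore ℂ X E ι) {i : ι} {x : X}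
    (hx : x ∈ Z.baseSet i) : (Z.coordChange i i x).det = 1 := by
  have h : (Z.coordChange i i x : E →ₗ[ℂ] E) = LinearMap.id :=
    LinearMap.ext fun v => Z.coordChange_self i x hx v
  change LinearMap.det _ = _
  rw [h, LinearMap.det_id]

lemma det_coordChange_ne_zero (Z : VectorBundleCore ℂ X E ι) {i j : ι} {x : X}
    (hx : x ∈ Z.baseSet i ∩ Z.baseSet j) : (Z.coordChange i j x).det ≠ 0 := by
  have h := det_coordChange_mul Z (i := i) (j := j) (k := i) ⟨hx, hx.1⟩
  rw [det_coordChange_self Z hx.1] at h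
  exact right_ne_zero_of_mul (h.trans_ne one_ne_zero)

/-- The unit circle bundle of the determinant line bundle of a complex vector bundle: the
transition functions are `det g / |det g|`, where `g` are those of the vector bundle. -/
def unitDet [FiniteDimensional ℂ E] (Z : VectorBundleCore ℂ X E ι) :
    FiberBundleCore ι X Circle where
  baseSet := Z.baseSet
  isOpen_baseSet := Z.isOpen_baseSet
  indexAt := Z.indexAt
  mem_baseSet_at := Z.mem_baseSet_at
  coordChange i j x u := phase (Z.coordChange i j x).det * u
  coordChange_self i x hx u := by rw [det_coordChange_self Z hx, phase_one, one_mul]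
  continuousOn_coordChange i j := by
    have hd : ContinuousOn (fun x => (Z.coordChange i j x).det) (Z.baseSet i ∩ Z.baseSet j) :=
      ContinuousLinearMap.continuous_det.comp_continuousOn (Z.continuousOn_coordChange i j)
    have hp := continuousOn_phase.comp hd fun x hx => det_coordChange_ne_zero Z hx
    exact (hp.comp continuousOn_fst fun y hy => hy.1).mul continuousOn_snd
  coordChange_comp i j k x hx u := by
    rw [← mul_assoc, ← phase_mul (det_coordChange_ne_zero Z ⟨hx.1.2, hx.2⟩)
      (det_coordChange_ne_zero Z hx.1), det_coordChange_mul Z hx]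

/-- The circle acts on the fibres of `unitDet Z` by multiplication. -/
instance [FiniteDimensional ℂ E] (Z : VectorBundleCore ℂ X E ι) :
    MulAction Circle (unitDet Z).TotalSpace where
  smul u y := ⟨y.1, u * show Circle from y.2⟩
  one_smul y := congrArg (Bundle.TotalSpace.mk y.1) (one_mul (show Circle from y.2))
  mul_smul u v y := congrArg (Bundle.TotalSpace.mk y.1) (mul_assoc u v (show Circle from y.2))

lemma isPrincipalCircleBundle_unitDet [FiniteDimensional ℂ E] (Z : VectorBundleCore ℂ X E ι) :
    IsPrincipalCircleBundle (unitDet Z).proj := by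
  refine ⟨fun x => ⟨(unitDet Z).localTriv (Z.indexAt x), Z.mem_baseSet_at x, ?_⟩⟩
  intro y hy u
  refine ⟨hy, ?_⟩
  exact congrArg (Prod.mk y.1)
    (mul_left_comm (phase (Z.coordChange _ _ _).det) u (show Circle from y.2))

/-- `x ∈ H²(X; ℤ)` is the first Chern class `c₁(X)` of the complex manifold `X`: it is the Euler
class of the unit circle bundle of the anticanonical line bundle `det TX`. -/
def IsFirstChernClass (E X : Type*) [NormedAddCommGroup E] [NormedSpace ℂ E]
    [FiniteDimensional ℂ E] [TopologicalSpace X] [ChartedSpace E X] [IsManifold 𝓘(ℂ, E) ω X]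
    (x : H2 X) : Prop :=
  IsEulerClass (unitDet (tangentBundleCore 𝓘(ℂ, E) X)).proj x

end Chern

/-! ### Complex projective space as a complex manifold -/

/-- Complex projective space `ℂP^k`. -/
abbrev CP (k : ℕ) := ℙ ℂ (Fin (k + 1) → ℂ)

section ProjectiveSpace

variable {k : ℕ}

/-- The quotient topology. -/
instance : TopologicalSpace (CP k) :=
  inferInstanceAs (TopologicalSpace (Quotient (projectivizationSetoid ℂ (Fin (k + 1) → ℂ))))

lemma isQuotientMap_mk' :
    Topology.IsQuotientMap (Projectivization.mk' ℂ : {v : Fin (k + 1) → ℂ // v ≠ 0} → CP k) :=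
  isQuotientMap_quot_mk

lemma exists_rep_mk {v : Fin (k + 1) → ℂ} (hv : v ≠ 0) :
    ∃ a : ℂ, a ≠ 0 ∧ (Projectivization.mk ℂ v hv).rep = a • v := by
  obtain ⟨a, ha⟩ := Projectivization.exists_smul_eq_mk_rep ℂ v hv
  exact ⟨a, a.ne_zero, ha.symm⟩

lemma isOpen_rep {Q : (Fin (k + 1) → ℂ) → Prop} (hQ : IsOpen {v | Q v})
    (h : ∀ (a : ℂ) v, a ≠ 0 → (Q (a • v) ↔ Q v)) : IsOpen {x : CP k | Q x.rep} := by
  rw [← isQuotientMap_mk'.isOpen_preimage]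
  convert hQ.preimage (continuous_subtype_val (p := fun v : Fin (k + 1) → ℂ => v ≠ 0)) using 1
  ext v
  obtain ⟨a, ha, h'⟩ := exists_rep_mk v.2
  change Q (Projectivization.mk ℂ v.1 v.2).rep ↔ Q v
  rw [h', h a _ ha]

/-- The quotient of two linear forms, as a function on (an open subset of) `ℂP^k`. -/
def ratio (num den : Fin (k + 1) → ℂ) (x : CP k) : ℂ := (num ⬝ᵥ x.rep) / (den ⬝ᵥ x.rep)

lemma ratio_mk (num den v : Fin (k + 1) → ℂ) (hv : v ≠ 0) :
    ratio num den (Projectivization.mk ℂ v hv) = (num ⬝ᵥ v) / (den ⬝ᵥ v) := by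
  obtain ⟨a, ha, h⟩ := exists_rep_mk hv
  rw [ratio, h, dotProduct_smul, dotProduct_smul, smul_eq_mul, smul_eq_mul,
    mul_div_mul_left _ _ ha]

lemma isOpen_den (den : Fin (k + 1) → ℂ) : IsOpen {x : CP k | den ⬝ᵥ x.rep ≠ 0} := by
  refine isOpen_rep (Q := fun v => den ⬝ᵥ v ≠ 0) ?_ ?_
  · exact isOpen_ne_fun (by fun_prop) continuous_const
  · intro a v ha
    simp [dotProduct_smul, ha]

lemma continuousOn_ratio (num den : Fin (k + 1) → ℂ) :
    ContinuousOn (ratio num den) {x : CP k | den ⬝ᵥ x.rep ≠ 0} := by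
  rw [isQuotientMap_mk'.continuousOn_isOpen_iff (isOpen_den den)]
  have h : ContinuousOn (fun v : {v : Fin (k + 1) → ℂ // v ≠ 0} => (num ⬝ᵥ v.1) / (den ⬝ᵥ v.1))
      {v | den ⬝ᵥ v.1 ≠ 0} := by
    refine ContinuousOn.div ?_ ?_ fun v hv => hv
    · exact Continuous.continuousOn (by fun_prop)
    · exact Continuous.continuousOn (by fun_prop)
  refine (h.congr fun v _ => ratio_mk num den v.1 v.2).mono ?_
  intro v hv
  obtain ⟨a, ha, h'⟩ := exists_rep_mk v.2
  change den ⬝ᵥ (Projectivization.mk ℂ v.1 v.2).rep ≠ 0 at hv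
  rw [h', dotProduct_smul] at hv
  exact right_ne_zero_of_mul hv

lemma insertNth_one_ne_zero (j : Fin (k + 1)) (z : Fin k → ℂ) :
    j.insertNth (1 : ℂ) z ≠ (0 : Fin (k + 1) → ℂ) := by
  intro h
  have := congrFun h j
  simp at this

/-- The `j`-th affine chart `[x₀ : … : x_k] ↦ (x_i / x_j)_{i ≠ j}`. -/
def affineChart (j : Fin (k + 1)) : OpenPartialHomeomorph (CP k) (Fin k → ℂ) where
  toFun x i := ratio (Pi.single (j.succAbove i) 1) (Pi.single j 1) x
  invFun z := Projectivization.mk ℂ (j.insertNth (1 : ℂ) z) (insertNth_one_ne_zero j z)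
  source := {x | Pi.single j 1 ⬝ᵥ x.rep ≠ 0}
  target := Set.univ
  map_source' _ _ := trivial
  map_target' z _ := by
    obtain ⟨a, ha, h⟩ := exists_rep_mk (insertNth_one_ne_zero j z)
    rw [Set.mem_ofPred_eq, h]
    simpa using ha
  left_inv' x hx := by
    have hx' : x.rep j ≠ 0 := by simpa using hx
    conv_rhs => rw [← x.mk_rep]
    rw [Projectivization.mk_eq_mk_iff']
    refine ⟨(x.rep j)⁻¹, ?_⟩
    ext i
    refine Fin.succAboveCases j ?_ (fun i => ?_) i
    · simp [hx']
    · simp [ratio, div_eq_inv_mul]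
  right_inv' z _ := by
    ext i
    rw [ratio_mk]
    simp
  open_source := isOpen_den _
  open_target := isOpen_univ
  continuousOn_toFun := continuousOn_pi.2 fun i => continuousOn_ratio _ _
  continuousOn_invFun := by
    refine Continuous.continuousOn ?_
    refine isQuotientMap_mk'.continuous.comp (Continuous.subtype_mk ?_ _)
    refine continuous_pi fun i => ?_
    refine Fin.succAboveCases j ?_ (fun i => ?_) i
    · simpa using continuous_const
    · simpa using continuous_apply i

lemma exists_mem_affineChart_source (x : CP k) : ∃ j, x ∈ (affineChart j).source := by
  obtain ⟨j, hj⟩ := Function.ne_iff.1 x.rep_nonzero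
  exact ⟨j, by simpa [affineChart] using hj⟩

instance : ChartedSpace (Fin k → ℂ) (CP k) where
  atlas := Set.range affineChart
  chartAt x := affineChart (exists_mem_affineChart_source x).choose
  mem_chart_source x := (exists_mem_affineChart_source x).choose_spec
  chart_mem_atlas _ := ⟨_, rfl⟩

instance : IsManifold 𝓘(ℂ, Fin k → ℂ) ω (CP k) := by
  refine isManifold_of_contDiffOn _ _ _ ?_
  rintro _ _ ⟨i, rfl⟩ ⟨j, rfl⟩
  have hc : ∀ l : Fin (k + 1),
      ContDiff ℂ ω fun z : Fin k → ℂ => (i.insertNth (1 : ℂ) z : Fin (k + 1) → ℂ) l := by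
    intro l
    refine Fin.succAboveCases i ?_ (fun l => ?_) l
    · simpa using contDiff_const
    · simpa using contDiff_apply ℂ ℂ l
  have h : ContDiffOn ℂ ω (fun (z : Fin k → ℂ) (l : Fin k) =>
      (i.insertNth (1 : ℂ) z : Fin (k + 1) → ℂ) (j.succAbove l) /
        (i.insertNth (1 : ℂ) z : Fin (k + 1) → ℂ) j)
      {z | (i.insertNth (1 : ℂ) z : Fin (k + 1) → ℂ) j ≠ 0} :=
    contDiffOn_pi.2 fun l => (hc _).contDiffOn.div (hc _).contDiffOn fun z hz => hz
  refine (h.mono ?_).congr ?_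
  · rintro z ⟨hz, -⟩
    have hz' : Pi.single j 1 ⬝ᵥ
        (Projectivization.mk ℂ (i.insertNth (1 : ℂ) z) (insertNth_one_ne_zero i z)).rep ≠ 0 := hz.2
    obtain ⟨a, ha, h'⟩ := exists_rep_mk (insertNth_one_ne_zero i z)
    rw [h', dotProduct_smul, single_one_dotProduct] at hz'
    exact right_ne_zero_of_mul hz'
  · intro z _
    ext l
    refine (ratio_mk _ _ _ (insertNth_one_ne_zero i z)).trans ?_
    rw [single_one_dotProduct, single_one_dotProduct]

end ProjectiveSpace

/-! ### The blow-up of the projective plane at finitely many points -/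

section BlowUp

variable {r : ℕ}

/-- The blow-up of `ℂP²` at the distinct points `p₁, …, p_r`: the points `(x, ℓ₁, …, ℓ_r)`, where
`x ∈ ℂP²` and `ℓᵢ` is a line through `pᵢ` and `x`. A line `{x | w ⬝ᵥ x = 0}` is recorded by the
point `[w]` of (the dual) `ℂP²`. Over `x ≠ pᵢ` the line `ℓᵢ` is determined by `x`, and over
`x = pᵢ` it runs through the pencil of all lines through `pᵢ`, the exceptional curve. -/
def BlowUp (p : Fin r ↪ CP 2) : Type :=
  {y : CP 2 × (Fin r → CP 2) // ∀ i, y.1.orthogonal (y.2 i) ∧ (p i).orthogonal (y.2 i)}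

variable {p : Fin r ↪ CP 2}

instance : TopologicalSpace (BlowUp p) :=
  inferInstanceAs (TopologicalSpace {y : CP 2 × (Fin r → CP 2) //
    ∀ i, y.1.orthogonal (y.2 i) ∧ (p i).orthogonal (y.2 i)})

namespace BlowUp

/-- The components of a point of the blow-up: `x` for `none`, and `ℓᵢ` for `some i`. -/
def pt (y : BlowUp p) : Option (Fin r) → CP 2
  | none => y.1.1
  | some i => y.1.2 i

lemma continuous_pt (a : Option (Fin r)) : Continuous fun y : BlowUp p => y.pt a := by
  cases a with
  | none => exact continuous_fst.comp continuous_subtype_val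
  | some i => exact (continuous_apply i).comp (continuous_snd.comp continuous_subtype_val)

@[ext] lemma ext {y y' : BlowUp p} (h : ∀ a, y.pt a = y'.pt a) : y = y' :=
  Subtype.ext (Prod.ext (h none) (funext fun i => h (some i)))

lemma orthogonal_iff_rep (x y : CP 2) : x.orthogonal y ↔ x.rep ⬝ᵥ y.rep = 0 := by
  conv_lhs => rw [← x.mk_rep, ← y.mk_rep]
  exact Projectivization.orthogonal_mk _ _

lemma eq_iff_rep (x y : CP 2) : x = y ↔ x.rep ⨯₃ y.rep = 0 := by
  conv_lhs => rw [← x.mk_rep, ← y.mk_rep]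
  exact Projectivization.mk_eq_mk_iff_crossProduct_eq_zero _ _

lemma eq_mk_iff (x : CP 2) {v : Fin 3 → ℂ} (hv : v ≠ 0) :
    x = Projectivization.mk ℂ v hv ↔ x.rep ⨯₃ v = 0 := by
  conv_lhs => rw [← x.mk_rep]
  exact Projectivization.mk_eq_mk_iff_crossProduct_eq_zero _ _

/-- The data of a chart of the blow-up, given by quotients of linear forms in the homogeneous
coordinates of the components, with inverse given by homogeneous coordinates `L`. -/
structure ChartData (p : Fin r ↪ CP 2) where
  L : Option (Fin r) → (Fin 2 → ℂ) → Fin 3 → ℂ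
  contDiff_L : ∀ a, ContDiff ℂ ω (L a)
  comp : Fin 2 → Option (Fin r)
  num : Fin 2 → Fin 3 → ℂ
  den : Fin 2 → Fin 3 → ℂ
  source : Set (BlowUp p)
  target : Set (Fin 2 → ℂ)
  isOpen_source : IsOpen source
  isOpen_target : IsOpen target
  L_ne_zero : ∀ z ∈ target, ∀ a, L a z ≠ 0
  incidence : ∀ z i, L none z ⬝ᵥ L (some i) z = 0 ∧ (p i).rep ⬝ᵥ L (some i) z = 0
  den_ne_zero : ∀ y ∈ source, ∀ m, den m ⬝ᵥ (y.pt (comp m)).rep ≠ 0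
  mem_source : ∀ z ∈ target, ∀ y : BlowUp p,
    (∀ a, ∃ c : ℂ, c ≠ 0 ∧ (y.pt a).rep = c • L a z) → y ∈ source
  coord : ∀ z ∈ target, ∀ m, (num m ⬝ᵥ L (comp m) z) / (den m ⬝ᵥ L (comp m) z) = z m
  mem_target : ∀ y ∈ source, (fun m => ratio (num m) (den m) (y.pt (comp m))) ∈ target
  cross : ∀ y ∈ source, ∀ a,
    (y.pt a).rep ⨯₃ L a (fun m => ratio (num m) (den m) (y.pt (comp m))) = 0

namespace ChartData

variable (D : ChartData p)

/-- The coordinates of a point. -/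
def toFun (y : BlowUp p) : Fin 2 → ℂ := fun m => ratio (D.num m) (D.den m) (y.pt (D.comp m))

/-- The point with given coordinates. -/
def point (z : D.target) : BlowUp p :=
  ⟨(Projectivization.mk ℂ (D.L none z) (D.L_ne_zero z z.2 none),
    fun i => Projectivization.mk ℂ (D.L (some i) z) (D.L_ne_zero z z.2 (some i))),
    fun i => by
      refine ⟨(Projectivization.orthogonal_mk _ _).2 (D.incidence z i).1, ?_⟩
      rw [← (p i).mk_rep]
      exact (Projectivization.orthogonal_mk _ _).2 (D.incidence z i).2⟩

lemma pt_point (z : D.target) (a : Option (Fin r)) :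
    (D.point z).pt a = Projectivization.mk ℂ (D.L a z) (D.L_ne_zero z z.2 a) := by
  cases a <;> rfl

lemma point_mem_source (z : D.target) : D.point z ∈ D.source := by
  refine D.mem_source z z.2 _ fun a => ?_
  rw [pt_point]
  exact exists_rep_mk _

lemma toFun_point (z : D.target) : D.toFun (D.point z) = z := by
  ext m
  rw [toFun, pt_point, ratio_mk, D.coord z z.2]

lemma point_toFun (y : BlowUp p) (hy : y ∈ D.source) :
    D.point ⟨D.toFun y, D.mem_target y hy⟩ = y := by
  ext a
  rw [pt_point]
  exact ((eq_mk_iff _ _).2 (D.cross y hy a)).symm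

lemma continuous_point : Continuous D.point := by
  have h : ∀ a, Continuous fun z : D.target =>
      (Projectivization.mk ℂ (D.L a z) (D.L_ne_zero z z.2 a) : CP 2) := fun a =>
    isQuotientMap_mk'.continuous.comp
      (Continuous.subtype_mk ((D.contDiff_L a).continuous.comp continuous_subtype_val) _)
  exact Continuous.subtype_mk ((h none).prodMk (continuous_pi fun i => h (some i))) _

lemma continuousOn_toFun : ContinuousOn D.toFun D.source :=
  continuousOn_pi.2 fun m => (continuousOn_ratio _ _).comp (continuous_pt _).continuousOn
    fun y hy => D.den_ne_zero y hy m

open Classical in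
/-- The chart defined by `D`. -/
def chart [Nonempty (BlowUp p)] : OpenPartialHomeomorph (BlowUp p) (Fin 2 → ℂ) where
  toFun := D.toFun
  invFun z := if h : z ∈ D.target then D.point ⟨z, h⟩ else Classical.arbitrary _
  source := D.source
  target := D.target
  map_source' := D.mem_target
  map_target' z hz := by rw [dif_pos hz]; exact D.point_mem_source _
  left_inv' y hy := (dif_pos (D.mem_target y hy)).trans (D.point_toFun y hy)
  right_inv' z hz := (congrArg D.toFun (dif_pos hz)).trans (D.toFun_point ⟨z, hz⟩)
  open_source := D.isOpen_source
  open_target := D.isOpen_target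
  continuousOn_toFun := D.continuousOn_toFun
  continuousOn_invFun := by
    rw [continuousOn_iff_continuous_domRestrict]
    refine D.continuous_point.congr fun z => ?_
    exact Eq.symm (dif_pos z.2)

lemma contDiffOn_chart [Nonempty (BlowUp p)] (D' : ChartData p) :
    ContDiffOn ℂ ω (D'.chart ∘ D.chart.symm) (D.chart.symm ≫ₕ D'.chart).source := by
  have h : ContDiffOn ℂ ω (fun (z : Fin 2 → ℂ) (m : Fin 2) =>
      (D'.num m ⬝ᵥ D.L (D'.comp m) z) / (D'.den m ⬝ᵥ D.L (D'.comp m) z))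
      {z | ∀ m, D'.den m ⬝ᵥ D.L (D'.comp m) z ≠ 0} := by
    have hd : ∀ (v : Fin 3 → ℂ) (a : Option (Fin r)), ContDiff ℂ ω fun z => v ⬝ᵥ D.L a z := by
      intro v a
      have := contDiff_pi.1 (D.contDiff_L a)
      simp only [dotProduct]
      exact ContDiff.sum fun i _ => contDiff_const.mul (this i)
    exact contDiffOn_pi.2 fun m => (hd _ _).contDiffOn.div (hd _ _).contDiffOn fun z hz => hz m
  have hs : ∀ z (hz : z ∈ D.target), D.chart.symm z = D.point ⟨z, hz⟩ := fun z hz => dif_pos hz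
  refine (h.mono ?_).congr ?_
  · rintro z ⟨hz, hz'⟩ m
    have hz1 : z ∈ D.target := hz
    have h2 := D'.den_ne_zero (D.chart.symm z) hz' m
    rw [hs z hz1, pt_point] at h2
    obtain ⟨a, ha, h'⟩ := exists_rep_mk (D.L_ne_zero z hz1 (D'.comp m))
    rw [h', dotProduct_smul] at h2
    exact right_ne_zero_of_mul h2
  · rintro z ⟨hz, -⟩
    have hz1 : z ∈ D.target := hz
    ext m
    change ratio _ _ ((D.chart.symm z).pt _) = _
    rw [hs z hz1, pt_point, ratio_mk]

end ChartData

/-- Cramer's rule. -/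
lemma cramer (C A B v : Fin 3 → ℂ) :
    (C ⬝ᵥ A ⨯₃ B) • v = (A ⨯₃ B ⬝ᵥ v) • C + (B ⨯₃ C ⬝ᵥ v) • A + (C ⨯₃ A ⬝ᵥ v) • B := by
  ext i
  fin_cases i <;> simp [cross_apply, dotProduct, Fin.sum_univ_three] <;> ring

lemma isOpen_ne_point (k : Fin r) : IsOpen {x : CP 2 | x.rep ⨯₃ (p k).rep ≠ 0} := by
  refine isOpen_rep (Q := fun v => v ⨯₃ (p k).rep ≠ 0) ?_ ?_
  · refine isOpen_ne_fun ?_ continuous_const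
    simp only [cross_apply]
    fun_prop
  · intro a v ha
    simp [ha]

lemma contDiff_cross {f g : (Fin 2 → ℂ) → Fin 3 → ℂ} (hf : ContDiff ℂ ω f)
    (hg : ContDiff ℂ ω g) : ContDiff ℂ ω fun z => f z ⨯₃ g z := by
  have hf' := contDiff_pi.1 hf
  have hg' := contDiff_pi.1 hg
  refine contDiff_pi.2 fun i => ?_
  simp only [cross_apply]
  fin_cases i
  · exact ((hf' 1).mul (hg' 2)).sub ((hf' 2).mul (hg' 1))
  · exact ((hf' 2).mul (hg' 0)).sub ((hf' 0).mul (hg' 2))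
  · exact ((hf' 0).mul (hg' 1)).sub ((hf' 1).mul (hg' 0))

lemma isOpen_cross_ne {f : (Fin 2 → ℂ) → Fin 3 → ℂ} (hf : ContDiff ℂ ω f) (w : Fin 3 → ℂ) :
    IsOpen {z | f z ⨯₃ w ≠ 0} :=
  isOpen_ne_fun (contDiff_cross hf contDiff_const).continuous continuous_const

/-- The incidence of the components, in homogeneous coordinates. -/
lemma dot_rep (y : BlowUp p) (i : Fin r) :
    (y.pt none).rep ⬝ᵥ (y.pt (some i)).rep = 0 ∧ (p i).rep ⬝ᵥ (y.pt (some i)).rep = 0 :=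
  ⟨(orthogonal_iff_rep _ _).1 (y.2 i).1, (orthogonal_iff_rep _ _).1 (y.2 i).2⟩

lemma cross_cross_eq_zero {v q w : Fin 3 → ℂ} (h1 : v ⬝ᵥ w = 0) (h2 : q ⬝ᵥ w = 0) :
    w ⨯₃ (v ⨯₃ q) = 0 := by
  rw [cross_cross_eq_smul_sub_smul', dotProduct_comm w q, h1, h2]
  simp

lemma planeL_eq_smul {C A B : Fin 3 → ℂ} (h : C ⬝ᵥ A ⨯₃ B ≠ 0) {x : CP 2}
    (hx : A ⨯₃ B ⬝ᵥ x.rep ≠ 0) : ∃ c : ℂ, c ≠ 0 ∧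
      C + ratio (B ⨯₃ C) (A ⨯₃ B) x • A + ratio (C ⨯₃ A) (A ⨯₃ B) x • B = c • x.rep := by
  refine ⟨(A ⨯₃ B ⬝ᵥ x.rep)⁻¹ * (C ⬝ᵥ A ⨯₃ B), mul_ne_zero (inv_ne_zero hx) h, ?_⟩
  rw [mul_smul, cramer C A B x.rep, smul_add, smul_add, smul_smul, smul_smul, smul_smul,
    inv_mul_cancel₀ hx, one_smul, ratio, ratio, div_eq_inv_mul, div_eq_inv_mul]

lemma den_dot (C A B : Fin 3 → ℂ) (a b : ℂ) :
    A ⨯₃ B ⬝ᵥ (C + a • A + b • B) = C ⬝ᵥ A ⨯₃ B ∧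
    B ⨯₃ C ⬝ᵥ (C + a • A + b • B) = a * (C ⬝ᵥ A ⨯₃ B) ∧
    C ⨯₃ A ⬝ᵥ (C + a • A + b • B) = b * (C ⬝ᵥ A ⨯₃ B) := by
  refine ⟨?_, ?_, ?_⟩ <;> simp [cross_apply, dotProduct, Fin.sum_univ_three] <;> ring

lemma contDiff_planeL (C A B : Fin 3 → ℂ) :
    ContDiff ℂ ω fun z : Fin 2 → ℂ => C + z 0 • A + z 1 • B :=
  (contDiff_const.add ((contDiff_apply ℂ ℂ 0).smul contDiff_const)).add
    ((contDiff_apply ℂ ℂ 1).smul contDiff_const)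

/-- Charts away from the exceptional curves. For a basis `C, A, B` of `ℂ³`, the coordinates of
`x = [C + z₀ A + z₁ B]` are `z`, and `ℓᵢ` is the line through `x` and `pᵢ`. -/
def planeData (p : Fin r ↪ CP 2) (C A B : Fin 3 → ℂ) (h : C ⬝ᵥ A ⨯₃ B ≠ 0) : ChartData p where
  L
    | none => fun z => C + z 0 • A + z 1 • B
    | some i => fun z => (C + z 0 • A + z 1 • B) ⨯₃ (p i).rep
  contDiff_L a := by
    cases a with
    | none => exact contDiff_planeL C A B
    | some i => exact contDiff_cross (contDiff_planeL C A B) contDiff_const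
  comp _ := none
  num := ![B ⨯₃ C, C ⨯₃ A]
  den _ := A ⨯₃ B
  source := {y | A ⨯₃ B ⬝ᵥ (y.pt none).rep ≠ 0 ∧ ∀ i, (y.pt none).rep ⨯₃ (p i).rep ≠ 0}
  target := {z | ∀ i, (C + z 0 • A + z 1 • B) ⨯₃ (p i).rep ≠ 0}
  isOpen_source := by
    have h1 := (isOpen_den (A ⨯₃ B)).preimage (continuous_pt (p := p) none)
    have h2 := isOpen_iInter_of_finite fun i =>
      (isOpen_ne_point (p := p) i).preimage (continuous_pt (p := p) none)
    convert h1.inter h2 using 1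
    ext y
    simp
  isOpen_target := by
    have h2 := isOpen_iInter_of_finite fun i =>
      isOpen_cross_ne (contDiff_planeL C A B) (p i).rep
    convert h2 using 1
    ext y
    simp
  L_ne_zero z hz a := by
    cases a with
    | none =>
      intro h0
      apply h
      have : (C + z 0 • A + z 1 • B) ⬝ᵥ A ⨯₃ B = 0 := by
        change C + z 0 • A + z 1 • B = 0 at h0
        rw [h0, zero_dotProduct]
      simpa [add_dotProduct, smul_dotProduct] using this
    | some i => exact hz i
  incidence z i := ⟨dot_self_cross _ _, dot_cross_self _ _⟩
  den_ne_zero y hy _ := hy.1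
  mem_source z hz y hy := by
    obtain ⟨c, hc, h'⟩ := hy none
    refine ⟨?_, fun i => ?_⟩
    · rw [h', dotProduct_smul, dotProduct_comm]
      simpa [add_dotProduct, smul_dotProduct, hc] using h
    · rw [h', map_smul, LinearMap.smul_apply]
      exact smul_ne_zero hc (hz i)
  coord z hz m := by
    obtain ⟨h0, h1, h2⟩ := den_dot C A B (z 0) (z 1)
    fin_cases m
    · exact (congrArg₂ (· / ·) h1 h0).trans (mul_div_cancel_right₀ _ h)
    · exact (congrArg₂ (· / ·) h2 h0).trans (mul_div_cancel_right₀ _ h)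
  mem_target y hy i := by
    obtain ⟨c, hc, h'⟩ := planeL_eq_smul h hy.1
    change (C + ratio (B ⨯₃ C) (A ⨯₃ B) (y.pt none) • A +
      ratio (C ⨯₃ A) (A ⨯₃ B) (y.pt none) • B) ⨯₃ (p i).rep ≠ 0
    rw [h', map_smul, LinearMap.smul_apply]
    exact smul_ne_zero hc (hy.2 i)
  cross y hy a := by
    obtain ⟨c, hc, h'⟩ := planeL_eq_smul h hy.1
    cases a with
    | none =>
      change (y.pt none).rep ⨯₃ (C + ratio (B ⨯₃ C) (A ⨯₃ B) (y.pt none) • A +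
        ratio (C ⨯₃ A) (A ⨯₃ B) (y.pt none) • B) = 0
      rw [h', map_smul, cross_self, smul_zero]
    | some i =>
      change (y.pt (some i)).rep ⨯₃ ((C + ratio (B ⨯₃ C) (A ⨯₃ B) (y.pt none) • A +
        ratio (C ⨯₃ A) (A ⨯₃ B) (y.pt none) • B) ⨯₃ (p i).rep) = 0
      rw [h', map_smul, LinearMap.smul_apply, map_smul,
        cross_cross_eq_zero (dot_rep y i).1 (dot_rep y i).2, smul_zero]

lemma contDiff_excL (P A B : Fin 3 → ℂ) :
    ContDiff ℂ ω (fun z : Fin 2 → ℂ => A + z 1 • B) ∧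
    ContDiff ℂ ω (fun z : Fin 2 → ℂ => P + z 0 • (A + z 1 • B)) := by
  have h : ContDiff ℂ ω (fun z : Fin 2 → ℂ => A + z 1 • B) :=
    contDiff_const.add ((contDiff_apply ℂ ℂ 1).smul contDiff_const)
  exact ⟨h, contDiff_const.add ((contDiff_apply ℂ ℂ 0).smul h)⟩

lemma excL_eq_smul {P A B : Fin 3 → ℂ} (h : P ⬝ᵥ A ⨯₃ B ≠ 0) {x l : CP 2}
    (hx : A ⨯₃ B ⬝ᵥ x.rep ≠ 0) (hl : B ⬝ᵥ l.rep ≠ 0) (h1 : x.rep ⬝ᵥ l.rep = 0)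
    (h2 : P ⬝ᵥ l.rep = 0) : ∃ c : ℂ, c ≠ 0 ∧
      P + ratio (B ⨯₃ P) (A ⨯₃ B) x • (A + ratio (-A) B l • B) = c • x.rep := by
  obtain ⟨c, hc, h'⟩ := planeL_eq_smul h hx
  refine ⟨c, hc, ?_⟩
  rw [← h', smul_add, smul_smul, add_assoc]
  congr 3
  have h3 := congrArg (· ⬝ᵥ l.rep) h'
  simp only [add_dotProduct, smul_dotProduct, h1, h2, smul_eq_mul, mul_zero, zero_add] at h3
  have h4 : ratio (-A) B l = -(A ⬝ᵥ l.rep) / (B ⬝ᵥ l.rep) := by rw [ratio, neg_dotProduct]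
  rw [h4]
  field_simp
  linear_combination -h3

lemma exc_dot (P A B : Fin 3 → ℂ) (t : ℂ) :
    B ⬝ᵥ (A + t • B) ⨯₃ P = -(P ⬝ᵥ A ⨯₃ B) ∧ -A ⬝ᵥ (A + t • B) ⨯₃ P = -(t * (P ⬝ᵥ A ⨯₃ B)) := by
  refine ⟨?_, ?_⟩ <;> simp [cross_apply, dotProduct, Fin.sum_univ_three] <;> ring

/-- Charts around the exceptional curve `E_j` over `pⱼ = [P]`. For a basis `P, A, B` of `ℂ³` they
are the standard charts of a blow-up: the coordinates of `x = [P + z₀ (A + z₁ B)]` on the line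
`ℓⱼ` through `P` and `A + z₁ B` are `z`. -/
def excData (p : Fin r ↪ CP 2) (j : Fin r) (A B : Fin 3 → ℂ) (h : (p j).rep ⬝ᵥ A ⨯₃ B ≠ 0) :
    ChartData p where
  L
    | none => fun z => (p j).rep + z 0 • (A + z 1 • B)
    | some i => if i = j then fun z => (A + z 1 • B) ⨯₃ (p j).rep
        else fun z => ((p j).rep + z 0 • (A + z 1 • B)) ⨯₃ (p i).rep
  contDiff_L a := by
    obtain ⟨h1, h2⟩ := contDiff_excL (p j).rep A B
    cases a with
    | none => exact h2
    | some i =>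
      dsimp only
      split_ifs
      · exact contDiff_cross h1 contDiff_const
      · exact contDiff_cross h2 contDiff_const
  comp := ![none, some j]
  num := ![B ⨯₃ (p j).rep, -A]
  den := ![A ⨯₃ B, B]
  source := {y | A ⨯₃ B ⬝ᵥ (y.pt none).rep ≠ 0 ∧ B ⬝ᵥ (y.pt (some j)).rep ≠ 0 ∧
    ∀ i, i ≠ j → (y.pt none).rep ⨯₃ (p i).rep ≠ 0}
  target := {z | ∀ i, i ≠ j → ((p j).rep + z 0 • (A + z 1 • B)) ⨯₃ (p i).rep ≠ 0}
  isOpen_source := by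
    have h1 := (isOpen_den (A ⨯₃ B)).preimage (continuous_pt (p := p) none)
    have h2 := (isOpen_den B).preimage (continuous_pt (p := p) (some j))
    have h3 := isOpen_iInter_of_finite fun i : {i // i ≠ j} =>
      (isOpen_ne_point (p := p) i).preimage (continuous_pt (p := p) none)
    convert h1.inter (h2.inter h3) using 1
    ext y
    simp
  isOpen_target := by
    have h2 := isOpen_iInter_of_finite fun i : {i // i ≠ j} =>
      isOpen_cross_ne (contDiff_excL (p j).rep A B).2 (p i).rep
    convert h2 using 1
    ext y
    simp
  L_ne_zero z hz a := by
    obtain ⟨h0, -, -⟩ := den_dot (p j).rep A B (z 0) (z 0 * z 1)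
    cases a with
    | none =>
      intro h1
      change (p j).rep + z 0 • (A + z 1 • B) = 0 at h1
      rw [smul_add, smul_smul, ← add_assoc] at h1
      rw [h1, dotProduct_zero] at h0
      exact h h0.symm
    | some i =>
      dsimp only
      split_ifs with hi
      · intro h1
        apply h
        change (A + z 1 • B) ⨯₃ (p j).rep = 0 at h1
        have h2 := (exc_dot (p j).rep A B (z 1)).1
        rw [h1, dotProduct_zero] at h2
        exact neg_eq_zero.1 h2.symm
      · exact hz i hi
  incidence z i := by
    dsimp only
    split_ifs with hi
    · subst hi
      refine ⟨?_, dot_cross_self _ _⟩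
      rw [add_dotProduct, smul_dotProduct, dot_cross_self, dot_self_cross]
      simp
    · exact ⟨dot_self_cross _ _, dot_cross_self _ _⟩
  den_ne_zero y hy m := by
    fin_cases m
    · exact hy.1
    · exact hy.2.1
  mem_source z hz y hy := by
    obtain ⟨c, hc, h'⟩ := hy none
    obtain ⟨d, hd, h''⟩ := hy (some j)
    dsimp only at h' h''
    rw [if_pos rfl] at h''
    obtain ⟨h0, -, -⟩ := den_dot (p j).rep A B (z 0) (z 0 * z 1)
    refine ⟨?_, ?_, fun i hi => ?_⟩
    · rw [h', dotProduct_smul, smul_add, smul_smul, ← add_assoc, h0]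
      exact mul_ne_zero hc h
    · rw [h'', dotProduct_smul, (exc_dot (p j).rep A B (z 1)).1]
      exact mul_ne_zero hd (neg_ne_zero.2 h)
    · rw [h', map_smul, LinearMap.smul_apply]
      exact smul_ne_zero hc (hz i hi)
  coord z hz m := by
    obtain ⟨h0, h1, -⟩ := den_dot (p j).rep A B (z 0) (z 0 * z 1)
    rw [add_assoc, ← smul_smul, ← smul_add] at h0 h1
    obtain ⟨h2, h3⟩ := exc_dot (p j).rep A B (z 1)
    fin_cases m
    · exact (congrArg₂ (· / ·) h1 h0).trans (mul_div_cancel_right₀ _ h)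
    · dsimp only
      change (-A ⬝ᵥ (if j = j then fun z : Fin 2 → ℂ => (A + z 1 • B) ⨯₃ (p j).rep else _) z) /
        (B ⬝ᵥ (if j = j then fun z : Fin 2 → ℂ => (A + z 1 • B) ⨯₃ (p j).rep else _) z) = z 1
      rw [if_pos rfl, h2, h3, neg_div_neg_eq, mul_div_cancel_right₀ _ h]
  mem_target y hy i hi := by
    obtain ⟨c, hc, h'⟩ := excL_eq_smul h hy.1 hy.2.1 (dot_rep y j).1 (dot_rep y j).2
    change ((p j).rep + ratio (B ⨯₃ (p j).rep) (A ⨯₃ B) (y.pt none) •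
      (A + ratio (-A) B (y.pt (some j)) • B)) ⨯₃ (p i).rep ≠ 0
    rw [h', map_smul, LinearMap.smul_apply]
    exact smul_ne_zero hc (hy.2.2 i hi)
  cross y hy a := by
    obtain ⟨c, hc, h'⟩ := excL_eq_smul h hy.1 hy.2.1 (dot_rep y j).1 (dot_rep y j).2
    cases a with
    | none =>
      change (y.pt none).rep ⨯₃ ((p j).rep + ratio (B ⨯₃ (p j).rep) (A ⨯₃ B) (y.pt none) •
        (A + ratio (-A) B (y.pt (some j)) • B)) = 0
      rw [h', map_smul, cross_self, smul_zero]
    | some i =>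
      dsimp only
      split_ifs with hi
      · subst hi
        change (y.pt (some i)).rep ⨯₃ ((A + ratio (-A) B (y.pt (some i)) • B) ⨯₃ (p i).rep) = 0
        refine cross_cross_eq_zero ?_ (dot_rep y i).2
        have := hy.2.1
        rw [add_dotProduct, smul_dotProduct, ratio, neg_dotProduct, smul_eq_mul,
          div_mul_cancel₀ _ this, add_neg_cancel]
      · change (y.pt (some i)).rep ⨯₃ (((p j).rep + ratio (B ⨯₃ (p j).rep) (A ⨯₃ B) (y.pt none) •
          (A + ratio (-A) B (y.pt (some j)) • B)) ⨯₃ (p i).rep) = 0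
        rw [h', map_smul, LinearMap.smul_apply, map_smul,
          cross_cross_eq_zero (dot_rep y i).1 (dot_rep y i).2, smul_zero]

lemma exists_triple {C w : Fin 3 → ℂ} (hC : C ≠ 0) (hw : w ≠ 0) (h : C ⬝ᵥ w = 0) :
    ∃ A B : Fin 3 → ℂ, C ⬝ᵥ A ⨯₃ B ≠ 0 ∧ B ⬝ᵥ w ≠ 0 := by
  obtain ⟨B, hB⟩ := Function.ne_iff.1 hw
  set b : Fin 3 → ℂ := Pi.single B 1 with hb
  have hbw : b ⬝ᵥ w ≠ 0 := by rw [hb, single_one_dotProduct]; exact hB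
  have hBC : b ⨯₃ C ≠ 0 := by
    intro h0
    have h1 := cross_cross_eq_smul_sub_smul' w b C
    rw [h0, map_zero, dotProduct_comm w C, h, zero_smul, zero_sub, zero_eq_neg] at h1
    exact smul_ne_zero hbw hC h1
  obtain ⟨a, ha⟩ := Function.ne_iff.1 hBC
  refine ⟨Pi.single a 1, b, ?_, hbw⟩
  rw [triple_product_permutation, single_one_dotProduct]
  exact ha

lemma exists_orthogonal (C : Fin 3 → ℂ) : ∃ w : Fin 3 → ℂ, w ≠ 0 ∧ C ⬝ᵥ w = 0 := by
  by_cases h : C 0 = 0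
  · exact ⟨Pi.single 0 1, by simp, by simpa using h⟩
  · refine ⟨![-C 1, C 0, 0], fun h' => h (by simpa using congrFun h' 1), ?_⟩
    simp [dotProduct, Fin.sum_univ_three]
    ring

/-- The charts of the blow-up. -/
def charts (p : Fin r ↪ CP 2) : Set (ChartData p) :=
  {D | (∃ C A B h, D = planeData p C A B h) ∨ ∃ j A B h, D = excData p j A B h}

lemma exists_chart (y : BlowUp p) : ∃ D ∈ charts p, y ∈ D.source := by
  by_cases hy : ∃ j, y.pt none = p j
  · obtain ⟨j, hj⟩ := hy
    obtain ⟨A, B, h, h'⟩ := exists_triple (p j).rep_nonzero (y.pt (some j)).rep_nonzero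
      (dot_rep y j).2
    refine ⟨excData p j A B h, Or.inr ⟨j, A, B, h, rfl⟩, ?_, h', fun i hi => ?_⟩
    · rw [hj, dotProduct_comm]; exact h
    · rw [hj, Ne, ← eq_iff_rep]
      exact fun h0 => hi (p.injective h0).symm
  · obtain ⟨w, hw, hw'⟩ := exists_orthogonal (y.pt none).rep
    obtain ⟨A, B, h, -⟩ := exists_triple (y.pt none).rep_nonzero hw hw'
    refine ⟨planeData p _ A B h, Or.inl ⟨_, A, B, h, rfl⟩, ?_, fun i => ?_⟩
    · rw [dotProduct_comm]; exact h
    · rw [Ne, ← eq_iff_rep]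
      exact fun h0 => hy ⟨i, h0⟩

instance : Nonempty (BlowUp p) := by
  classical
  let x : CP 2 := Classical.arbitrary _
  have h : ∀ i, ∃ l : CP 2, x.orthogonal l ∧ (p i).orthogonal l := by
    intro i
    by_cases hi : x = p i
    · obtain ⟨w, hw, hw'⟩ := exists_orthogonal (p i).rep
      have h' : (p i).orthogonal (Projectivization.mk ℂ w hw) := by
        rw [← (p i).mk_rep]
        exact (Projectivization.orthogonal_mk _ _).2 hw'
      exact ⟨_, hi ▸ h', h'⟩
    · exact ⟨_, Projectivization.orthogonal_cross_left hi,
        Projectivization.orthogonal_cross_right hi⟩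
  choose l hl using h
  exact ⟨⟨(x, l), hl⟩⟩

instance : ChartedSpace (Fin 2 → ℂ) (BlowUp p) where
  atlas := (fun D : ChartData p => D.chart) '' charts p
  chartAt y := (exists_chart y).choose.chart
  mem_chart_source y := (exists_chart y).choose_spec.2
  chart_mem_atlas y := Set.mem_image_of_mem _ (exists_chart y).choose_spec.1

instance : IsManifold 𝓘(ℂ, Fin 2 → ℂ) ω (BlowUp p) := by
  refine isManifold_of_contDiffOn _ _ _ ?_
  rintro _ _ ⟨D, -, rfl⟩ ⟨D', -, rfl⟩
  exact (D.contDiffOn_chart D').mono fun z hz => hz.1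

end BlowUp

/-- Eight points of the plane are in general position: no three of them lie on a line, no six of
them lie on a conic, and no cubic that passes through all of them is singular at one of them. -/
structure InGeneralPosition (p : Fin 8 ↪ CP 2) : Prop where
  line : ∀ F : MvPolynomial (Fin 3) ℂ, F.IsHomogeneous 1 → F ≠ 0 →
    {i | MvPolynomial.eval (p i).rep F = 0}.ncard ≤ 2
  conic : ∀ F : MvPolynomial (Fin 3) ℂ, F.IsHomogeneous 2 → F ≠ 0 →
    {i | MvPolynomial.eval (p i).rep F = 0}.ncard ≤ 5
  cubic : ∀ F : MvPolynomial (Fin 3) ℂ, F.IsHomogeneous 3 → F ≠ 0 →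
    (∀ i, MvPolynomial.eval (p i).rep F = 0) →
    ∀ i, ∃ j, MvPolynomial.eval (p i).rep (MvPolynomial.pderiv j F) ≠ 0

end BlowUp

end

end CircleBundle

open CircleBundle

/-! In the homotopy sequence π₂(M) → π₁(S¹) → π₁(P) → π₁(M) of the bundle, the connecting map is, up
to sign, the evaluation of the Euler class on spheres. Hence P is simply connected as soon as M is
simply connected and the Euler class takes the value 1 or -1 on some sphere. This is
`IsPrincipalCircleBundle.simplyConnectedSpace`.

The sphere is an exceptional curve E of the blow-up, placed at a point of the other two factors. The
classes pulled back from those factors vanish on it, and c₁(R₈) takes the value 1: the tangent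
bundle of E has degree 2 and its normal bundle has degree -1. In the proof this number is a winding
number. The standard charts along E are related by (z₀, z₁) ↦ (z₀ z₁, 1/z₁), whose Jacobian
determinant is -1/z₁ (`det_coordChange_excPoint`), and a sphere along which the determinants of the
transition functions have this form has value 1 (`evalSphere_eq_one_of_det`). So [ω] is 1 on E and
the Euler class is -1.

For the base, `SimplyConnectedSpace.of_affine_cover` is van Kampen's theorem for a cover by affine
spaces through a common point. It applies to projective space with its affine charts. For the
blow-up, the complement of a line through a generic point Q and of the proper transforms of the
lines from Q to the centres is an affine plane (`exists_pencil_chart`), and any two points lie in a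
common plane of this kind (`exists_pencil`).

The homotopy sequence is replaced by explicit 2-simplices. A null-homotopy in M is a 2-simplex, the
definition of an obstruction cochain provides lifts of 2-simplices, and the boundary of a lift is
compared with an orbit through angle functions. -/

/-! ### Simply connected spaces -/

section SimplyConnected

open Path.Homotopic unitInterval

variable {X Y : Type*} [TopologicalSpace X] [TopologicalSpace Y]

lemma IsSimplyConnected.homotopic {s : Set X} (hs : IsSimplyConnected s) {x y : X}
    {p q : Path x y} (hp : ∀ t, p t ∈ s) (hq : ∀ t, q t ∈ s) : p.Homotopic q := by
  have := hs.simplyConnectedSpace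
  have hx : x ∈ s := by simpa using hp 0
  have hy : y ∈ s := by simpa using hp 1
  let p' : Path (⟨x, hx⟩ : s) ⟨y, hy⟩ :=
    { toFun := fun t => ⟨p t, hp t⟩, source' := by simp, target' := by simp }
  let q' : Path (⟨x, hx⟩ : s) ⟨y, hy⟩ :=
    { toFun := fun t => ⟨q t, hq t⟩, source' := by simp, target' := by simp }
  exact (SimplyConnectedSpace.paths_homotopic p' q').map ⟨Subtype.val, continuous_subtype_val⟩

/-- A family of homotopy classes of paths which is compatible with all paths that are small of
order an open cover is compatible with all paths. -/
lemma Path.Homotopic.Quotient.trans_eq_of_open_cover {ι : Type*} {U : ι → Set X}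
    (hU : ∀ i, IsOpen (U i)) (hc : ∀ x, ∃ i, x ∈ U i) {x₀ : X}
    (c : ∀ x, Path.Homotopic.Quotient x₀ x)
    (h : ∀ i {x y : X} (p : Path x y), (∀ t, p t ∈ U i) → (c x).trans (.mk p) = c y)
    {x y : X} (p : Path x y) : (c x).trans (.mk p) = c y := by
  -- A Lebesgue subdivision cuts `p` into pieces that each lie in one `U i`; the hypothesis carries
  -- the identity across one piece at a time.
  obtain ⟨t, ht0, htm, ⟨n, hn⟩, ht⟩ :=
    exists_monotone_Icc_subset_open_cover_unitInterval (c := fun i => p ⁻¹' U i)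
      (fun i => (hU i).preimage p.continuous) (fun s _ => by simpa using hc (p s))
  have key : ∀ m, (c (p 0)).trans (.mk (p.subpath 0 (t m))) = c (p (t m)) := by
    intro m
    induction m with
    | zero =>
      obtain ⟨i, hi⟩ := ht 0
      refine h i _ fun s => ?_
      have : p.subpath 0 (t 0) s ∈ Set.range (p.subpath 0 (t 0)) := ⟨s, rfl⟩
      rw [Path.range_subpath] at this
      obtain ⟨r, hr, hr'⟩ := this
      rw [ht0, Set.uIcc_self] at hr
      rw [← hr', hr]
      exact hi ⟨ht0.le, (htm (Nat.zero_le 1)).trans' ht0.ge⟩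
    | succ m ih =>
      rw [← Path.Homotopic.Quotient.eq.2 ⟨Path.Homotopy.subpathTransSubpath p 0 (t m) (t (m + 1))⟩,
        mk_trans, ← trans_assoc, ih]
      obtain ⟨i, hi⟩ := ht m
      refine h i _ fun s => ?_
      have : p.subpath (t m) (t (m + 1)) s ∈ Set.range (p.subpath (t m) (t (m + 1))) := ⟨s, rfl⟩
      rw [Path.range_subpath_of_le _ _ _ (htm (Nat.le_succ m))] at this
      obtain ⟨r, hr, hr'⟩ := this
      rw [← hr']
      exact hi hr
  have := key n
  rw [hn n le_rfl, Path.subpath_zero_one] at this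
  -- The endpoints of the full subpath are `p 0` and `p 1`, which equal `x` and `y` only
  -- propositionally.
  have hcast : ∀ {a b : X} (ha : a = x) (hb : b = y),
      (c a).trans (.mk (p.cast ha hb)) = c b → (c x).trans (.mk p) = c y := by
    rintro _ _ rfl rfl h
    exact h
  exact hcast _ _ this

/-- A path from `x₀` to `x` inside one `U i` has a class that does not depend on `i`, because two
such sets meet in a path connected set. These classes are compatible with short paths, hence with
all paths, so two paths with the same ends become equal after composition with the same class, which
can be cancelled. -/
theorem SimplyConnectedSpace.of_open_cover {ι : Type*} {U : ι → Set X}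
    (hU : ∀ i, IsOpen (U i)) (hc : ∀ x, ∃ i, x ∈ U i) {x₀ : X} (h₀ : ∀ i, x₀ ∈ U i)
    (hs : ∀ i, IsSimplyConnected (U i)) (hI : ∀ i j, IsPathConnected (U i ∩ U j)) :
    SimplyConnectedSpace X := by
  have hj : ∀ x, ∃ (i : ι) (p : Path x₀ x), ∀ t, p t ∈ U i := by
    intro x
    obtain ⟨i, hi⟩ := hc x
    have hJ := (hs i).isPathConnected.joinedIn x₀ (h₀ i) x hi
    exact ⟨i, hJ.somePath, hJ.somePath_mem⟩
  choose i p hp using hj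
  have hpU : ∀ x k (q : Path x₀ x), (∀ t, q t ∈ U k) → (p x).Homotopic q := by
    intro x k q hq
    have hx : x ∈ U (i x) ∩ U k := ⟨by simpa using hp x 1, by simpa using hq 1⟩
    -- A path in the intersection is homotopic to `p x` inside one set and to `q` inside the other.
    have hJ := (hI (i x) k).joinedIn x₀ ⟨h₀ _, h₀ _⟩ x hx
    exact ((hs _).homotopic (hp x) fun t => (hJ.somePath_mem t).1).trans
      ((hs k).homotopic (fun t => (hJ.somePath_mem t).2) hq)
  have key : ∀ {x y : X} (q : Path x y),
      (Path.Homotopic.Quotient.mk (p x)).trans (.mk q) = .mk (p y) := by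
    refine Path.Homotopic.Quotient.trans_eq_of_open_cover hU hc (fun x => .mk (p x)) ?_
    intro k x y q hq
    have hx : x ∈ U k := by simpa using hq 0
    have hJ := (hs k).isPathConnected.joinedIn x₀ (h₀ k) x hx
    rw [Path.Homotopic.Quotient.eq.2 (hpU x k hJ.somePath hJ.somePath_mem),
      ← Path.Homotopic.Quotient.mk_trans, eq_comm]
    refine Path.Homotopic.Quotient.eq.2 (hpU y k _ fun t => ?_)
    have : (hJ.somePath.trans q) t ∈ Set.range (hJ.somePath.trans q) := ⟨t, rfl⟩
    rw [Path.trans_range] at this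
    obtain ⟨s, hs⟩ | ⟨s, hs⟩ := this
    · rw [← hs]; exact hJ.somePath_mem s
    · rw [← hs]; exact hq s
  rw [simply_connected_iff_paths_homotopic']
  refine ⟨⟨⟨x₀⟩, fun x y => ⟨(p x).symm.trans (p y)⟩⟩, fun {x y} q q' => ?_⟩
  rw [← Path.Homotopic.Quotient.eq]
  have h := (key q).trans (key q').symm
  have h2 := congrArg (fun z => (Path.Homotopic.Quotient.mk (p x)).symm.trans z) h
  simpa [← Path.Homotopic.Quotient.trans_assoc] using h2

instance [SimplyConnectedSpace X] [SimplyConnectedSpace Y] : SimplyConnectedSpace (X × Y) := by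
  rw [simply_connected_iff_paths_homotopic]
  refine ⟨inferInstance, fun x y => ⟨fun p q => ?_⟩⟩
  rw [← prod_projLeft_projRight p, ← prod_projLeft_projRight q]
  congr 1 <;> exact Subsingleton.elim _ _

end SimplyConnected

/-! ### Spaces covered by affine spaces -/

section AnalyticComplement

variable {E : Type*} [NormedAddCommGroup E] [NormedSpace ℂ E]

/-- The complement of finitely many zero sets of entire functions is path connected. -/
lemma isPathConnected_forall_ne_zero {ι : Type*} [Finite ι] {G : ι → E → ℂ}
    (hG : ∀ i, ContDiff ℂ ω (G i)) (hne : ∃ z, ∀ i, G i z ≠ 0) :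
    IsPathConnected {z | ∀ i, G i z ≠ 0} := by
  obtain ⟨a, ha⟩ := hne
  refine ⟨a, ha, fun {b} hb => ?_⟩
  -- On the complex line through `a` and `b` each function is entire and nonzero at `a`, so its
  -- zeros are isolated and therefore countable. A countable set does not disconnect ℂ, which has
  -- real dimension 2.
  let f : ℂ → E := fun t => a + t • (b - a)
  have hf : ContDiff ℂ ω f := by fun_prop
  have hcount : (⋃ i, {t | G i (f t) = 0}).Countable := by
    refine Set.countable_iUnion fun i => ?_
    have hA : AnalyticOnNhd ℂ (fun t => G i (f t)) Set.univ :=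
      fun t _ => ((hG i).comp hf).contDiffAt.analyticAt
    have hd := hA.preimage_zero_mem_codiscrete (x := 0) (by simpa [f] using ha i)
    have h2 := (mem_codiscrete'.1 hd).2
    refine ((HereditarilyLindelofSpace.isLindelof _).countable_of_isDiscrete h2).mono ?_
    intro t ht
    simpa using ht
  have hpc := hcount.isPathConnected_compl_of_one_lt_rank (E := ℂ)
    (by simp [Complex.rank_real_complex])
  have h1 := hpc.joinedIn 0 (by simpa [f] using ha) 1 (by simpa [f] using hb)
  have h2 := h1.map (f := f) hf.continuous
  simp only [f, zero_smul, add_zero, one_smul, add_sub_cancel] at h2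
  refine h2.mono ?_
  rintro _ ⟨t, ht, rfl⟩
  simpa [f] using ht

end AnalyticComplement

section AffineCover

variable {X E : Type*} [TopologicalSpace X] [NormedAddCommGroup E] [NormedSpace ℂ E]

/-- A space that is covered by affine spaces with a common point, which meet in complements of
zero sets of entire functions, is simply connected. -/
theorem SimplyConnectedSpace.of_affine_cover {ι κ : Type*} [Finite κ]
    (e : ι → OpenPartialHomeomorph X E)
    (ht : ∀ i, (e i).target = Set.univ) (hc : ∀ x, ∃ i, x ∈ (e i).source) {x₀ : X}
    (h₀ : ∀ i, x₀ ∈ (e i).source)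
    (hG : ∀ i j, ∃ G : κ → E → ℂ, (∀ k, ContDiff ℂ ω (G k)) ∧
      ∀ z, (e i).symm z ∈ (e j).source ↔ ∀ k, G k z ≠ 0) : SimplyConnectedSpace X := by
  let _ : NormedSpace ℝ E := NormedSpace.restrictScalars ℝ ℂ E
  refine .of_open_cover (fun i => (e i).open_source) hc h₀ (fun i => ?_) fun i j => ?_
  · have hE : (e i).source ≃ₜ E :=
      (e i).toHomeomorphSourceTarget.trans ((Homeomorph.setCongr (ht i)).trans (Homeomorph.Set.univ E))
    exact hE.toHomotopyEquiv.simplyConnectedSpace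
  · obtain ⟨G, hGc, hG⟩ := hG i j
    have h : IsPathConnected {z | ∀ k, G k z ≠ 0} := by
      -- The common point `x₀` shows that none of the functions vanishes identically.
      refine isPathConnected_forall_ne_zero hGc ⟨e i x₀, (hG _).1 ?_⟩
      rw [(e i).left_inv (h₀ i)]
      exact h₀ j
    have hcont : Continuous (e i).symm := by
      rw [← continuousOn_univ, ← ht i]
      exact (e i).continuousOn_symm
    convert h.image hcont using 1
    ext x
    constructor
    · rintro ⟨hi, hj⟩
      refine ⟨e i x, (hG _).1 ?_, (e i).left_inv hi⟩
      rwa [(e i).left_inv hi]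
    · rintro ⟨z, hz, rfl⟩
      exact ⟨(e i).map_target (by rw [ht i]; trivial), (hG z).2 hz⟩

end AffineCover

/-! ### Complex projective space is simply connected -/

namespace CircleBundle

lemma contDiff_insertNth_one {k : ℕ} (i l : Fin (k + 1)) :
    ContDiff ℂ ω fun z : Fin k → ℂ => (i.insertNth (1 : ℂ) z : Fin (k + 1) → ℂ) l := by
  refine Fin.succAboveCases i ?_ (fun l => ?_) l
  · simpa using contDiff_const
  · simpa using contDiff_apply ℂ ℂ l

/-- The point [1 : … : 1] lies in every affine chart, and in the `i`-th chart the overlap with the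
`j`-th one is the locus where the `j`-th homogeneous coordinate is nonzero. -/
instance {k : ℕ} : SimplyConnectedSpace (CP k) := by
  have h1 : (1 : Fin (k + 1) → ℂ) ≠ 0 := one_ne_zero
  refine .of_affine_cover (κ := Unit) affineChart (fun _ => rfl) exists_mem_affineChart_source
    (x₀ := Projectivization.mk ℂ 1 h1) (fun j => ?_) fun i j => ?_
  · obtain ⟨a, ha, h⟩ := exists_rep_mk h1
    change Pi.single j 1 ⬝ᵥ (Projectivization.mk ℂ 1 h1).rep ≠ 0
    rw [h]
    simpa using ha
  · refine ⟨fun (_ : Unit) z => (i.insertNth (1 : ℂ) z : Fin (k + 1) → ℂ) j,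
      fun _ => contDiff_insertNth_one i j, fun z => ?_⟩
    change Pi.single j 1 ⬝ᵥ
      (Projectivization.mk ℂ (i.insertNth (1 : ℂ) z) (insertNth_one_ne_zero i z)).rep ≠ 0 ↔ _
    obtain ⟨a, ha, h⟩ := exists_rep_mk (insertNth_one_ne_zero i z)
    rw [h, dotProduct_smul, single_one_dotProduct]
    simp [ha]

end CircleBundle

/-! ### Polynomial interpolation and a parametrized affine plane -/

section Interpolation

open Polynomial

/-- The curve of all `(s, t, m)` with `t - b i = m i * (s - a i)` is a plane. -/
lemma exists_parametrization {ι : Type*} [Fintype ι] [Nonempty ι] {a : ι → ℂ}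
    (ha : Function.Injective a) (b : ι → ℂ) :
    ∃ (F : (Fin 2 → ℂ) → ℂ) (N : ι → (Fin 2 → ℂ) → ℂ) (W : ℂ → (ι → ℂ) → ℂ),
      ContDiff ℂ ω F ∧ (∀ i, ContDiff ℂ ω (N i)) ∧
      Continuous (Function.uncurry W) ∧
      (∀ i z, F z - b i = N i z * (z 0 - a i)) ∧
      (∀ s t m, (∀ i, t - b i = m i * (s - a i)) →
        F ![s, W s m] = t ∧ ∀ i, N i ![s, W s m] = m i) ∧
      ∀ z, W (z 0) (fun i => N i z) = z 1 := by
  classical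
  -- The interpolation polynomial f gives one solution t = f(s), mᵢ = gᵢ(s) for each s. The others
  -- are t = f(s) + w ∏ (s - aₖ), mᵢ = gᵢ(s) + w Rᵢ(s), where Rᵢ omits the `i`-th factor; w is the
  -- second coordinate.
  have hdvd : ∀ i, ∃ g : ℂ[X],
      Lagrange.interpolate Finset.univ a b - C (b i) = (X - C (a i)) * g := by
    intro i
    refine Polynomial.dvd_iff_isRoot.2 ?_
    rw [IsRoot, eval_sub, eval_C, Lagrange.eval_interpolate_at_node b ha.injOn (Finset.mem_univ i),
      sub_self]
  choose g hg using hdvd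
  set f := Lagrange.interpolate Finset.univ a b
  have hfg : ∀ i s, f.eval s - b i = (s - a i) * (g i).eval s := by
    intro i s
    simpa using congrArg (eval s) (hg i)
  let R : ι → ℂ → ℂ := fun i s => ∏ k ∈ Finset.univ.erase i, (s - a k)
  -- The Lagrange basis polynomials cᵢ Rᵢ add up to 1, so w = ∑ cᵢ (mᵢ - gᵢ(s)). This recovers w
  -- also at the nodes, where ∏ (s - aₖ) = 0 and t says nothing about w.
  obtain ⟨c, hc⟩ : ∃ c : ι → ℂ, ∀ s, ∑ i, c i * R i s = 1 := by
    refine ⟨fun i => ∏ k ∈ Finset.univ.erase i, (a i - a k)⁻¹, fun s => ?_⟩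
    have := congrArg (eval s) (Lagrange.sum_basis (s := Finset.univ) ha.injOn Finset.univ_nonempty)
    simpa [eval_finsetSum, Lagrange.basis, eval_prod, Lagrange.basisDivisor,
      Finset.prod_mul_distrib, R] using this
  have hpoly : ∀ q : ℂ[X], ContDiff ℂ ω fun z : Fin 2 → ℂ => q.eval (z 0) := fun q => by
    have := (q.contDiff_aeval (𝕜 := ℂ) ω).comp (contDiff_apply ℂ ℂ (0 : Fin 2))
    simpa [Function.comp_def, aeval_def] using this
  have hR : ∀ i, ContDiff ℂ ω fun z : Fin 2 → ℂ => R i (z 0) := fun i =>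
    contDiff_prod fun k _ => (contDiff_apply ℂ ℂ (0 : Fin 2)).sub contDiff_const
  have hRR : ∀ i s, (∏ k, (s - a k)) = (s - a i) * R i s := fun i s =>
    (Finset.mul_prod_erase _ _ (Finset.mem_univ i)).symm
  refine ⟨fun z => f.eval (z 0) + (∏ k, (z 0 - a k)) * z 1,
    fun i z => (g i).eval (z 0) + R i (z 0) * z 1,
    fun s m => ∑ i, c i * (m i - (g i).eval s), ?_, fun i => ?_, ?_, fun i z => ?_,
    fun s t m h => ?_, fun z => ?_⟩
  · exact (hpoly f).add ((contDiff_prod fun k _ => (contDiff_apply ℂ ℂ (0 : Fin 2)).sub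
      contDiff_const).mul (contDiff_apply ℂ ℂ 1))
  · exact (hpoly _).add ((hR i).mul (contDiff_apply ℂ ℂ 1))
  · simp only [Function.uncurry_def]
    refine continuous_finsetSum _ fun i _ => continuous_const.mul (Continuous.sub ?_ ?_)
    · fun_prop
    · exact (g i).continuous.comp continuous_fst
  · dsimp only
    rw [hRR i, add_sub_right_comm, hfg]
    ring
  · have hd : ∀ i, t - f.eval s = (s - a i) * (m i - (g i).eval s) := fun i => by
      linear_combination h i - hfg i s
    -- The vectors (mᵢ - gᵢ(s)) and (Rᵢ(s)) are proportional. Both sides are the same product over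
    -- the indices other than `i` and `k`, times t - f(s), so nothing is divided and `s` may be a
    -- node.
    have hx : ∀ i k, R i s * (m k - (g k).eval s) = R k s * (m i - (g i).eval s) := by
      intro i k
      by_cases hik : i = k
      · rw [hik]
      have h1 : R i s = (s - a k) * ∏ l ∈ (Finset.univ.erase i).erase k, (s - a l) :=
        (Finset.mul_prod_erase _ _ (by simp [Ne.symm hik])).symm
      have h2 : R k s = (s - a i) * ∏ l ∈ (Finset.univ.erase k).erase i, (s - a l) :=
        (Finset.mul_prod_erase _ _ (by simp [hik])).symm
      rw [h1, h2, Finset.erase_right_comm]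
      linear_combination (∏ l ∈ (Finset.univ.erase k).erase i, (s - a l)) * (hd i - hd k)
    have hN : ∀ i, (g i).eval s + R i s * ∑ k, c k * (m k - (g k).eval s) = m i := by
      intro i
      have : R i s * ∑ k, c k * (m k - (g k).eval s) =
          (∑ k, c k * R k s) * (m i - (g i).eval s) := by
        rw [Finset.mul_sum, Finset.sum_mul]
        exact Finset.sum_congr rfl fun k _ => by linear_combination c k * hx i k
      rw [this, hc]
      ring
    obtain ⟨i⟩ := ‹Nonempty ι›
    refine ⟨?_, hN⟩
    simp only [Matrix.cons_val_zero, Matrix.cons_val_one, hRR i]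
    linear_combination (s - a i) * hN i - h i + hfg i s
  · simp only [add_sub_cancel_left, ← mul_assoc, ← Finset.sum_mul, hc, one_mul]

end Interpolation

/-! ### Affine planes in the blow-up -/

namespace CircleBundle.BlowUp

/-- Finitely many proper subspaces do not cover ℂ³. This supplies the generic choices in
`exists_pencil`. -/
lemma exists_forall_dotProduct_ne_zero {κ : Type*} [Finite κ] {v : κ → Fin 3 → ℂ}
    (hv : ∀ k, v k ≠ 0) : ∃ w, ∀ k, w ⬝ᵥ v k ≠ 0 := by
  obtain ⟨w, hw⟩ := Module.Dual.exists_forall_ne_zero_of_forall_exists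
    (fun k => (dotProductBilin ℂ ℂ).flip (v k) : κ → Module.Dual ℂ (Fin 3 → ℂ)) fun k => by
      obtain ⟨i, hi⟩ := Function.ne_iff.1 (hv k)
      exact ⟨Pi.single i 1, by simpa using hi⟩
  exact ⟨w, hw⟩

end CircleBundle.BlowUp

namespace CircleBundle.BlowUp

variable {r : ℕ} {p : Fin r ↪ CP 2}

/-- The linear forms that vanish nowhere on the complement of a line through `[Q]` and of the
proper transforms of the lines that join `[Q]` and the centres of the blow-up. -/
def pencilDen (A Q : Fin 3 → ℂ) : Option (Fin r) → Fin 3 → ℂ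
  | none => A ⨯₃ Q
  | some _ => Q

/-- The complement in the blow-up of a line through `[Q]` and of the proper transforms of the lines
that join `[Q]` and the centres is an affine plane. -/
lemma exists_pencil_chart [Nonempty (Fin r)] {O A Q : Fin 3 → ℂ} (h : O ⬝ᵥ A ⨯₃ Q ≠ 0)
    (hp : ∀ i, A ⨯₃ Q ⬝ᵥ (p i).rep ≠ 0)
    (hinj : Function.Injective fun i => ratio (Q ⨯₃ O) (A ⨯₃ Q) (p i)) :
    ∃ (e : OpenPartialHomeomorph (BlowUp p) (Fin 2 → ℂ))
      (V : Option (Fin r) → (Fin 2 → ℂ) → Fin 3 → ℂ),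
      e.target = Set.univ ∧ e.source = {y | ∀ a, pencilDen A Q a ⬝ᵥ (y.pt a).rep ≠ 0} ∧
      (∀ a, ContDiff ℂ ω (V a)) ∧ ∀ z a, ∃ c : ℂ, c ≠ 0 ∧ ((e.symm z).pt a).rep = c • V a z := by
  -- Off the line `A ⨯₃ Q`, points are [O + s A + t Q], and the centres have affine coordinates (aᵢ,
  -- bᵢ). A line ℓᵢ through the `i`-th centre that avoids [Q] has a direction A + mᵢ Q, and it
  -- contains the point exactly when t - bᵢ = mᵢ (s - aᵢ). Injectivity of the aᵢ says that no two
  -- centres are collinear with [Q].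
  obtain ⟨F, N, W, hF, hN, hW, hFN, hsol, hWN⟩ :=
    exists_parametrization hinj fun i => ratio (O ⨯₃ A) (A ⨯₃ Q) (p i)
  let V : Option (Fin r) → (Fin 2 → ℂ) → Fin 3 → ℂ
    | none => fun z => O + z 0 • A + F z • Q
    | some i => fun z => (A + N i z • Q) ⨯₃ (p i).rep
  have hVc : ∀ a, ContDiff ℂ ω (V a) := by
    rintro (_ | i)
    · exact (contDiff_const.add ((contDiff_apply ℂ ℂ 0).smul contDiff_const)).add
        (hF.smul contDiff_const)
    · exact contDiff_cross (contDiff_const.add ((hN i).smul contDiff_const)) contDiff_const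
  have hVd : ∀ a z, pencilDen A Q a ⬝ᵥ V a z ≠ 0 := by
    rintro (_ | i) z
    · change A ⨯₃ Q ⬝ᵥ (O + z 0 • A + F z • Q) ≠ 0
      rw [(den_dot O A Q _ _).1]
      exact h
    · change Q ⬝ᵥ (A + N i z • Q) ⨯₃ (p i).rep ≠ 0
      rw [(exc_dot (p i).rep A Q _).1, dotProduct_comm]
      exact neg_ne_zero.2 (hp i)
  have hV0 : ∀ a z, V a z ≠ 0 := fun a z h0 => hVd a z (by rw [h0, dotProduct_zero])
  have hP : ∀ i, ∃ c : ℂ, c ≠ 0 ∧ O + ratio (Q ⨯₃ O) (A ⨯₃ Q) (p i) • A +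
      ratio (O ⨯₃ A) (A ⨯₃ Q) (p i) • Q = c • (p i).rep := fun i => planeL_eq_smul h (hp i)
  -- The point differs from a multiple of the centre by a multiple of A + Nᵢ Q, so it lies on the
  -- line spanned by these two.
  have hinc : ∀ z i, V none z ⬝ᵥ V (some i) z = 0 := by
    intro z i
    obtain ⟨c, -, hc⟩ := hP i
    have : V none z = (z 0 - ratio (Q ⨯₃ O) (A ⨯₃ Q) (p i)) • (A + N i z • Q) + c • (p i).rep := by
      rw [← hc]
      change O + z 0 • A + F z • Q = _
      rw [eq_add_of_sub_eq (hFN i z)]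
      module
    rw [this, add_dotProduct, smul_dotProduct, smul_dotProduct]
    change _ • ((A + N i z • Q) ⬝ᵥ (A + N i z • Q) ⨯₃ (p i).rep) +
      c • ((p i).rep ⬝ᵥ (A + N i z • Q) ⨯₃ (p i).rep) = 0
    rw [dot_self_cross, dot_cross_self, smul_zero, smul_zero, add_zero]
  let pnt : (Fin 2 → ℂ) → BlowUp p := fun z =>
    ⟨(Projectivization.mk ℂ (V none z) (hV0 none z),
      fun i => Projectivization.mk ℂ (V (some i) z) (hV0 (some i) z)), fun i => by
      refine ⟨(Projectivization.orthogonal_mk _ _).2 (hinc z i), ?_⟩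
      rw [← (p i).mk_rep]
      exact (Projectivization.orthogonal_mk _ _).2 (dot_cross_self _ _)⟩
  have hpnt : ∀ z a, (pnt z).pt a = Projectivization.mk ℂ (V a z) (hV0 a z) := by
    rintro z (_ | i) <;> rfl
  let toF : BlowUp p → Fin 2 → ℂ := fun y =>
    ![ratio (Q ⨯₃ O) (A ⨯₃ Q) (y.pt none),
      W (ratio (Q ⨯₃ O) (A ⨯₃ Q) (y.pt none)) fun i => ratio (-A) Q (y.pt (some i))]
  have hleft : ∀ y : BlowUp p, (∀ a, pencilDen A Q a ⬝ᵥ (y.pt a).rep ≠ 0) → pnt (toF y) = y := by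
    intro y hy
    obtain ⟨c, hc0, hc⟩ := planeL_eq_smul h (hy none)
    -- The point and the centre both lie on ℓᵢ; subtracting the two incidence equations gives the
    -- slope equation.
    have hm : ∀ i, ratio (O ⨯₃ A) (A ⨯₃ Q) (y.pt none) - ratio (O ⨯₃ A) (A ⨯₃ Q) (p i) =
        ratio (-A) Q (y.pt (some i)) *
          (ratio (Q ⨯₃ O) (A ⨯₃ Q) (y.pt none) - ratio (Q ⨯₃ O) (A ⨯₃ Q) (p i)) := by
      intro i
      obtain ⟨d, -, hd⟩ := hP i
      have h1 := congrArg (· ⬝ᵥ (y.pt (some i)).rep) hc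
      have h2 := congrArg (· ⬝ᵥ (y.pt (some i)).rep) hd
      simp only [add_dotProduct, smul_dotProduct, (dot_rep y i).1, (dot_rep y i).2, smul_eq_mul,
        mul_zero] at h1 h2
      have hQ : Q ⬝ᵥ (y.pt (some i)).rep ≠ 0 := hy (some i)
      rw [show ratio (-A) Q (y.pt (some i)) =
        -(A ⬝ᵥ (y.pt (some i)).rep) / (Q ⬝ᵥ (y.pt (some i)).rep) by rw [ratio, neg_dotProduct]]
      field_simp
      linear_combination h1 - h2
    obtain ⟨h1, h2⟩ := hsol _ _ _ hm
    ext a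
    rw [hpnt]
    refine ((eq_mk_iff _ _).2 ?_).symm
    rcases a with _ | i
    · change (y.pt none).rep ⨯₃ (O + _ • A + F (toF y) • Q) = 0
      rw [h1]
      change (y.pt none).rep ⨯₃ (O + ratio (Q ⨯₃ O) (A ⨯₃ Q) (y.pt none) • A + _) = 0
      rw [hc, map_smul, cross_self, smul_zero]
    · change (y.pt (some i)).rep ⨯₃ ((A + N i (toF y) • Q) ⨯₃ (p i).rep) = 0
      rw [h2]
      refine cross_cross_eq_zero ?_ (dot_rep y i).2
      have : Q ⬝ᵥ (y.pt (some i)).rep ≠ 0 := hy (some i)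
      rw [add_dotProduct, smul_dotProduct, ratio, neg_dotProduct, smul_eq_mul,
        div_mul_cancel₀ _ this, add_neg_cancel]
  have hmem : ∀ z a, pencilDen A Q a ⬝ᵥ ((pnt z).pt a).rep ≠ 0 := by
    intro z a
    obtain ⟨c, hc, h'⟩ := exists_rep_mk (hV0 a z)
    rw [hpnt, h', dotProduct_smul]
    exact mul_ne_zero hc (hVd a z)
  have hright : ∀ z, toF (pnt z) = z := by
    intro z
    have h1 : ratio (Q ⨯₃ O) (A ⨯₃ Q) ((pnt z).pt none) = z 0 := by
      rw [hpnt, ratio_mk]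
      change (Q ⨯₃ O ⬝ᵥ (O + z 0 • A + F z • Q)) / (A ⨯₃ Q ⬝ᵥ (O + z 0 • A + F z • Q)) = z 0
      rw [(den_dot O A Q _ _).1, (den_dot O A Q _ _).2.1, mul_div_cancel_right₀ _ h]
    have h2 : ∀ i, ratio (-A) Q ((pnt z).pt (some i)) = N i z := by
      intro i
      rw [hpnt, ratio_mk]
      change (-A ⬝ᵥ (A + N i z • Q) ⨯₃ (p i).rep) / (Q ⬝ᵥ (A + N i z • Q) ⨯₃ (p i).rep) = _
      have := hp i
      rw [dotProduct_comm] at this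
      rw [(exc_dot (p i).rep A Q _).1, (exc_dot (p i).rep A Q _).2, neg_div_neg_eq,
        mul_div_cancel_right₀ _ this]
    ext m
    fin_cases m
    · exact h1
    · change W (ratio (Q ⨯₃ O) (A ⨯₃ Q) ((pnt z).pt none))
        (fun i => ratio (-A) Q ((pnt z).pt (some i))) = z 1
      simp only [h1, h2, hWN]
  have hopen : IsOpen {y : BlowUp p | ∀ a, pencilDen A Q a ⬝ᵥ (y.pt a).rep ≠ 0} := by
    simp only [Set.ofPred_forall]
    exact isOpen_iInter_of_finite fun a => (isOpen_den (pencilDen A Q a)).preimage (continuous_pt a)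
  refine ⟨{
    toFun := toF
    invFun := pnt
    source := {y | ∀ a, pencilDen A Q a ⬝ᵥ (y.pt a).rep ≠ 0}
    target := Set.univ
    map_source' := fun _ _ => trivial
    map_target' := fun z _ => hmem z
    left_inv' := hleft
    right_inv' := fun z _ => hright z
    open_source := hopen
    open_target := isOpen_univ
    continuousOn_toFun := ?_
    continuousOn_invFun := ?_ }, V, rfl, rfl, hVc, fun z a => ?_⟩
  · have h1 : ContinuousOn (fun y : BlowUp p => ratio (Q ⨯₃ O) (A ⨯₃ Q) (y.pt none))
        {y | ∀ a, pencilDen A Q a ⬝ᵥ (y.pt a).rep ≠ 0} :=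
      (continuousOn_ratio _ _).comp (continuous_pt _).continuousOn fun y hy => hy none
    have h2 : ContinuousOn (fun (y : BlowUp p) i => ratio (-A) Q (y.pt (some i)))
        {y | ∀ a, pencilDen A Q a ⬝ᵥ (y.pt a).rep ≠ 0} :=
      continuousOn_pi.2 fun i => (continuousOn_ratio _ _).comp (continuous_pt _).continuousOn
        fun y hy => hy (some i)
    refine continuousOn_pi.2 fun m => ?_
    fin_cases m
    · exact h1
    · exact hW.comp_continuousOn (h1.prodMk h2)
  · have hm : ∀ a, Continuous fun z => (Projectivization.mk ℂ (V a z) (hV0 a z) : CP 2) := fun a =>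
      isQuotientMap_mk'.continuous.comp ((hVc a).continuous.subtype_mk _)
    exact (Continuous.subtype_mk ((hm none).prodMk (continuous_pi fun i => hm (some i)))
      _).continuousOn
  · change ∃ c : ℂ, c ≠ 0 ∧ ((pnt z).pt a).rep = c • V a z
    rw [hpnt]
    exact exists_rep_mk _

/-- Any two points of the blow-up lie in one of the affine planes above. -/
lemma exists_pencil [Nonempty (Fin r)] (x y : BlowUp p) : ∃ O A Q : Fin 3 → ℂ,
    (O ⬝ᵥ A ⨯₃ Q ≠ 0 ∧ (∀ i, A ⨯₃ Q ⬝ᵥ (p i).rep ≠ 0) ∧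
      Function.Injective fun i => ratio (Q ⨯₃ O) (A ⨯₃ Q) (p i)) ∧
    (∀ a, pencilDen A Q a ⬝ᵥ (x.pt a).rep ≠ 0) ∧ ∀ a, pencilDen A Q a ⬝ᵥ (y.pt a).rep ≠ 0 := by
  -- `Q` is chosen off the lines that join two centres and off all lines ℓᵢ belonging to `x` and to
  -- `y`.
  obtain ⟨i₀⟩ := ‹Nonempty (Fin r)›
  obtain ⟨Q, hQ⟩ := exists_forall_dotProduct_ne_zero
    (v := fun k : {k : Fin r × Fin r // k.1 ≠ k.2} ⊕ (Fin r ⊕ Fin r) =>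
      Sum.elim (fun k => (p k.1.1).rep ⨯₃ (p k.1.2).rep)
        (Sum.elim (fun i => (x.pt (some i)).rep) fun i => (y.pt (some i)).rep) k) (by
      rintro (⟨k, hk⟩ | i | i)
      · exact fun h0 => hk (p.injective ((eq_iff_rep _ _).2 h0))
      · exact Projectivization.rep_nonzero _
      · exact Projectivization.rep_nonzero _)
  have hQp : ∀ i j, i ≠ j → Q ⬝ᵥ (p i).rep ⨯₃ (p j).rep ≠ 0 := fun i j hij =>
    hQ (.inl ⟨(i, j), hij⟩)
  have hQx : ∀ i, Q ⬝ᵥ (x.pt (some i)).rep ≠ 0 := fun i => hQ (.inr (.inl i))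
  have hQy : ∀ i, Q ⬝ᵥ (y.pt (some i)).rep ≠ 0 := fun i => hQ (.inr (.inr i))
  -- A line `l` through `v` that avoids `Q` shows that `Q` and `v` are different points. For the
  -- images of `x` and `y` in the plane the line with index `i₀` is used, which is why a centre must
  -- exist.
  have hcross : ∀ {v l : Fin 3 → ℂ}, v ≠ 0 → v ⬝ᵥ l = 0 → Q ⬝ᵥ l ≠ 0 → Q ⨯₃ v ≠ 0 := by
    intro v l hv hvl hQl h0
    have h1 := cross_cross_eq_smul_sub_smul Q v l
    rw [h0, map_zero, LinearMap.zero_apply, hvl, zero_smul, sub_zero] at h1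
    exact smul_ne_zero hQl hv h1.symm
  -- `A` is generic, so that the line `A ⨯₃ Q` through `Q` misses the centres and the images of `x`
  -- and `y`.
  obtain ⟨A, hA⟩ := exists_forall_dotProduct_ne_zero
    (v := fun k : Fin r ⊕ Bool =>
      Q ⨯₃ Sum.elim (fun i => (p i).rep) (fun b => cond b (x.pt none).rep (y.pt none).rep) k) (by
      rintro (i | _ | _)
      · exact hcross (p i).rep_nonzero (dot_rep x i).2 (hQx i)
      · exact hcross (Projectivization.rep_nonzero _) (dot_rep y i₀).1 (hQy i₀)
      · exact hcross (Projectivization.rep_nonzero _) (dot_rep x i₀).1 (hQx i₀))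
  have hAv : ∀ v, A ⨯₃ Q ⬝ᵥ v = A ⬝ᵥ Q ⨯₃ v := fun v => by
    rw [dotProduct_comm, triple_product_permutation]
  have hAp : ∀ i, A ⨯₃ Q ⬝ᵥ (p i).rep ≠ 0 := fun i => by
    rw [hAv]
    exact hA (.inl i)
  have hO : (p i₀).rep ⬝ᵥ A ⨯₃ Q ≠ 0 := by
    rw [dotProduct_comm]
    exact hAp i₀
  -- Any point off the line `A ⨯₃ Q` may serve as origin, for instance a centre.
  refine ⟨(p i₀).rep, A, Q, ⟨hO, hAp, fun i j hij => ?_⟩, ?_, ?_⟩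
  -- Equal first coordinates would make `Q` and two centres collinear.
  · by_contra hne
    obtain ⟨c, hc, h1⟩ := planeL_eq_smul hO (hAp i)
    obtain ⟨d, hd, h2⟩ := planeL_eq_smul hO (hAp j)
    have h3 : Q ⬝ᵥ (c • (p i).rep) ⨯₃ (d • (p j).rep) = 0 := by
      dsimp only at hij
      rw [← h1, ← h2, hij]
      simp [cross_apply, dotProduct, Fin.sum_univ_three]
      ring
    rw [map_smul, map_smul, LinearMap.smul_apply, dotProduct_smul, dotProduct_smul] at h3
    exact mul_ne_zero hd (mul_ne_zero hc (hQp i j hne)) h3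
  · rintro (_ | i)
    · change A ⨯₃ Q ⬝ᵥ _ ≠ 0
      rw [hAv]
      exact hA (.inr true)
    · exact hQx i
  · rintro (_ | i)
    · change A ⨯₃ Q ⬝ᵥ _ ≠ 0
      rw [hAv]
      exact hA (.inr false)
    · exact hQy i

/-- The blow-up of the projective plane is simply connected. -/
instance [Nonempty (Fin r)] : SimplyConnectedSpace (BlowUp p) := by
  let x₀ : BlowUp p := Classical.arbitrary _
  -- The cover consists of all such planes through `x₀`; it is exhaustive because every point shares
  -- one of them with `x₀`.
  let ι := {d : (Fin 3 → ℂ) × (Fin 3 → ℂ) × (Fin 3 → ℂ) //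
    (d.1 ⬝ᵥ d.2.1 ⨯₃ d.2.2 ≠ 0 ∧ (∀ i, d.2.1 ⨯₃ d.2.2 ⬝ᵥ (p i).rep ≠ 0) ∧
      Function.Injective fun i => ratio (d.2.2 ⨯₃ d.1) (d.2.1 ⨯₃ d.2.2) (p i)) ∧
    ∀ a, pencilDen d.2.1 d.2.2 a ⬝ᵥ (x₀.pt a).rep ≠ 0}
  choose e V ht hs hV hVe using fun d : ι => exists_pencil_chart d.2.1.1 d.2.1.2.1 d.2.1.2.2
  refine .of_affine_cover (κ := Option (Fin r)) e ht (fun y => ?_) (x₀ := x₀) (fun d => ?_)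
    fun d d' => ?_
  · obtain ⟨O, A, Q, h, h1, h2⟩ := exists_pencil x₀ y
    refine ⟨⟨(O, A, Q), h, h1⟩, ?_⟩
    rw [hs]
    exact h2
  · rw [hs]
    exact d.2.2
  · refine ⟨fun a z => pencilDen d'.1.2.1 d'.1.2.2 a ⬝ᵥ V d a z, fun a => ?_, fun z => ?_⟩
    · have := contDiff_pi.1 (hV d a)
      simp only [dotProduct]
      exact ContDiff.sum fun i _ => contDiff_const.mul (this i)
    · rw [hs]
      refine forall_congr' fun a => ?_
      obtain ⟨c, hc, h⟩ := hVe d z a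
      rw [h, dotProduct_smul]
      simp [hc]

end CircleBundle.BlowUp

namespace CircleBundle

noncomputable section

/-! ### Evaluation of cohomology classes on spheres -/

section Evaluation

variable {X Y : Type*} [TopologicalSpace X] [TopologicalSpace Y]

/-- The evaluation of classes of degree two on a singular `2`-simplex with constant boundary. -/
def evalSphere (σ : SingularSimplex 2 X) (x : X) (hσ : ∀ i, face i σ = .const _ x) : H2 X →+ ℤ :=
  QuotientAddGroup.lift _
    -- The boundary of `σ` is a constant 1-simplex, not zero, since the signs are +, -, +. The
    -- constant 2-simplex has the same boundary, so the difference is a cycle.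
    { toFun := fun c => c.1 σ - c.1 (.const _ x)
      map_zero' := by simp
      map_add' := fun a b => by
        change (a.1 σ + b.1 σ) - (a.1 (.const _ x) + b.1 (.const _ x)) = _
        ring } (by
    rintro c ⟨b, hb⟩
    change c.1 σ - c.1 (.const _ x) = 0
    have hb' : coboundary 1 X b = c.1 := hb
    rw [← hb', sub_eq_zero]
    change ∑ i : Fin 3, (-1) ^ (i : ℕ) * b (face i σ) =
      ∑ i : Fin 3, (-1) ^ (i : ℕ) * b (face i (.const _ x))
    simp only [hσ]
    rfl)

variable {σ : SingularSimplex 2 X} {x : X} (hσ : ∀ i, face i σ = .const _ x)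

lemma evalSphere_mk (c : (coboundary 2 X).ker) :
    evalSphere σ x hσ (QuotientAddGroup.mk c) = c.1 σ - c.1 (.const _ x) := rfl

lemma face_comp_eq_const {σ : SingularSimplex 2 X} {x : X} (hσ : ∀ i, face i σ = .const _ x)
    (f : C(X, Y)) (i : Fin 3) : face i (f.comp σ) = .const _ (f x) :=
  congrArg f.comp (hσ i)

lemma evalSphere_map (f : C(X, Y)) (c : H2 Y) :
    evalSphere σ x hσ (H2.map f c) =
      evalSphere (f.comp σ) (f x) (face_comp_eq_const hσ f) c := by
  induction c using QuotientAddGroup.induction_on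
  rfl

lemma evalSphere_const (x : X) (c : H2 X) :
    evalSphere (.const _ x) x (fun _ => rfl) c = 0 := by
  induction c using QuotientAddGroup.induction_on
  exact sub_self _

end Evaluation

/-! ### Lifts and angles in principal circle bundles -/

instance (ι : Type*) [Fintype ι] [Nonempty ι] : ContractibleSpace (stdSimplex ℝ ι) :=
  (convex_stdSimplex ℝ ι).contractibleSpace Set.Nonempty.of_subtype

instance (ι : Type*) [Fintype ι] : LocallyPathConnectedSpace (stdSimplex ℝ ι) :=
  (convex_stdSimplex ℝ ι).locallyPathConnectedSpace

instance : LocallyPathConnectedSpace unitInterval :=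
  (convex_Icc (0 : ℝ) 1).locallyPathConnectedSpace

instance : ContractibleSpace unitInterval :=
  (convex_Icc (0 : ℝ) 1).contractibleSpace ⟨0, by simp⟩

/-- A circle valued map on a simply connected space has an angle function, whose value at a point
may be prescribed. -/
lemma exists_angle {T : Type*} [TopologicalSpace T] [SimplyConnectedSpace T]
    [LocallyPathConnectedSpace T] (g : C(T, Circle)) (t₀ : T) {θ : ℝ}
    (hθ : g t₀ = Circle.exp (2 * Real.pi * θ)) :
    ∃ G : C(T, ℝ), G t₀ = θ ∧ ∀ t, g t = Circle.exp (2 * Real.pi * G t) := by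
  obtain ⟨F, ⟨h0, hF⟩, -⟩ := Circle.isCoveringMap_exp.existsUnique_continuousMap_lifts g t₀
    (2 * Real.pi * θ) hθ.symm
  have hpi : 2 * Real.pi ≠ 0 := by positivity
  refine ⟨⟨fun t => F t / (2 * Real.pi), by fun_prop⟩, ?_, fun t => ?_⟩
  · change F t₀ / (2 * Real.pi) = θ
    rw [h0, mul_div_cancel_left₀ _ hpi]
  · change g t = Circle.exp (2 * Real.pi * (F t / (2 * Real.pi)))
    rw [mul_div_cancel₀ _ hpi]
    exact (congrFun hF t).symm

lemma exists_exp_eq (u : Circle) : ∃ θ : ℝ, u = Circle.exp (2 * Real.pi * θ) := by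
  refine ⟨(u : ℂ).arg / (2 * Real.pi), ?_⟩
  rw [mul_div_cancel₀ _ (by positivity), Circle.exp_arg]

lemma exp_eq_iff {a b : ℝ} : Circle.exp (2 * Real.pi * a) = Circle.exp (2 * Real.pi * b) ↔
    ∃ m : ℤ, a = b + m := by
  rw [Circle.exp_eq_exp]
  have hpi : 2 * Real.pi ≠ 0 := by positivity
  refine exists_congr fun m => ⟨fun h => mul_left_cancel₀ hpi ?_, fun h => ?_⟩
  · rw [h]; ring
  · rw [h]; ring

/-- Two angle functions of the same map differ by a constant. -/
lemma angle_sub_eq {T : Type*} [TopologicalSpace T] [PreconnectedSpace T] {f f' : C(T, ℝ)}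
    (h : ∀ t, Circle.exp (2 * Real.pi * f t) = Circle.exp (2 * Real.pi * f' t)) (s t : T) :
    f s - f' s = f t - f' t := by
  have := Circle.isCoveringMap_exp.const_of_comp
    (g := fun t => 2 * Real.pi * f t - 2 * Real.pi * f' t) (by fun_prop)
    (fun s t => by simp [Circle.exp_sub, h]) s t
  have hpi : 2 * Real.pi ≠ 0 := by positivity
  refine mul_left_cancel₀ hpi ?_
  linarith

/-- The total increment of a function on the `1`-simplex. -/
def increment (f : SingularSimplex 1 ℝ) : ℝ := f (stdSimplex.vertex 1) - f (stdSimplex.vertex 0)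

lemma increment_eq_of_exp_eq {f f' : SingularSimplex 1 ℝ}
    (h : ∀ t, Circle.exp (2 * Real.pi * f t) = Circle.exp (2 * Real.pi * f' t)) :
    increment f = increment f' := by
  have := angle_sub_eq h (stdSimplex.vertex 1) (stdSimplex.vertex 0)
  simp only [increment]
  linarith

lemma map_vertex {m n : ℕ} (f : Fin m → Fin n) (i : Fin m) :
    stdSimplex.map f (stdSimplex.vertex (S := ℝ) i) = stdSimplex.vertex (f i) := by
  simp

lemma face_vertex {X : Type*} [TopologicalSpace X] {k : ℕ} (i : Fin (k + 2))
    (σ : SingularSimplex (k + 1) X) (j : Fin (k + 1)) :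
    face i σ (stdSimplex.vertex j) = σ (stdSimplex.vertex (i.succAbove j)) :=
  congrArg σ (map_vertex _ _)

/-- The increments of a function along the boundary of a `2`-simplex add up to zero. -/
lemma sum_increment_face (G : SingularSimplex 2 ℝ) :
    ∑ i : Fin 3, (-1 : ℝ) ^ (i : ℕ) * increment (face i G) = 0 := by
  have h : ∀ i : Fin 3, increment (face i G) =
      G (stdSimplex.vertex (i.succAbove 1)) - G (stdSimplex.vertex (i.succAbove 0)) := fun i => by
    rw [increment, face_vertex, face_vertex]
  simp only [Fin.sum_univ_three, h]
  have h1 : (0 : Fin 3).succAbove (0 : Fin 2) = 1 := by decide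
  have h2 : (0 : Fin 3).succAbove (1 : Fin 2) = 2 := by decide
  have h3 : (1 : Fin 3).succAbove (0 : Fin 2) = 0 := by decide
  have h4 : (1 : Fin 3).succAbove (1 : Fin 2) = 2 := by decide
  have h5 : (2 : Fin 3).succAbove (0 : Fin 2) = 0 := by decide
  have h6 : (2 : Fin 3).succAbove (1 : Fin 2) = 1 := by decide
  rw [h1, h2, h3, h4, h5, h6]
  simp

namespace IsPrincipalCircleBundle

variable {P X : Type*} [TopologicalSpace P] [TopologicalSpace X] [MulAction Circle P]
  {π : P → X} (hπ : IsPrincipalCircleBundle π)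

include hπ

lemma proj_smul (u : Circle) (y : P) : π (u • y) = π y := by
  obtain ⟨e, he, h⟩ := hπ.exists_trivialization (π y)
  have hy : y ∈ e.source := e.mem_source.2 he
  obtain ⟨h1, h2⟩ := h y hy u
  rw [← e.coe_fst h1, h2, e.coe_fst hy]

/-- Continuity of the action is not part of the definition of a bundle; it is read off from the
trivializations, where the action is multiplication in the circle factor. -/
lemma continuous_smul : Continuous fun q : Circle × P => q.1 • q.2 := by
  rw [continuous_iff_continuousAt]
  rintro ⟨u, y⟩
  obtain ⟨e, he, h⟩ := hπ.exists_trivialization (π y)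
  have hy : y ∈ e.source := e.mem_source.2 he
  have hc : ContinuousOn (fun q : Circle × P =>
      e.toOpenPartialHomeomorph.symm ((e q.2).1, q.1 * (e q.2).2)) (Set.univ ×ˢ e.source) := by
    have hes : ContinuousOn e e.source := e.toOpenPartialHomeomorph.continuousOn
    have he' : ContinuousOn (fun q : Circle × P => e q.2) (Set.univ ×ˢ e.source) :=
      hes.comp continuousOn_snd fun q hq => hq.2
    refine e.toOpenPartialHomeomorph.symm.continuousOn.comp
      (he'.fst.prodMk (continuousOn_fst.mul he'.snd)) ?_
    intro q hq
    have : e (q.1 • q.2) ∈ e.target := e.map_source (h q.2 hq.2 q.1).1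
    rwa [(h q.2 hq.2 q.1).2] at this
  refine (hc.congr ?_).continuousAt ((isOpen_univ.prod e.open_source).mem_nhds ⟨trivial, hy⟩)
  intro q hq
  obtain ⟨h1, h2⟩ := h q.2 hq.2 q.1
  dsimp only
  rw [← h2]
  exact (e.left_inv h1).symm

lemma smul_left_injective {u v : Circle} {y : P} (huv : u • y = v • y) : u = v := by
  obtain ⟨e, he, h⟩ := hπ.exists_trivialization (π y)
  have hy : y ∈ e.source := e.mem_source.2 he
  have h1 := (h y hy u).2
  rw [huv, (h y hy v).2] at h1
  exact (mul_right_cancel (Prod.ext_iff.1 h1).2).symm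

/-- Two lifts of the same map differ by a circle valued function. -/
lemma exists_div {T : Type*} [TopologicalSpace T] (τ τ' : C(T, P))
    (h : ∀ t, π (τ' t) = π (τ t)) : ∃ g : C(T, Circle), ∀ t, τ' t = g t • τ t := by
  have hloc : ∀ (e : Bundle.Trivialization Circle π),
      (∀ y ∈ e.source, ∀ u : Circle, u • y ∈ e.source ∧ e (u • y) = ((e y).1, u * (e y).2)) →
      ∀ t, π (τ t) ∈ e.baseSet → τ' t = ((e (τ' t)).2 * (e (τ t)).2⁻¹) • τ t := by
    intro e he t ht
    have h1 : τ t ∈ e.source := e.mem_source.2 ht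
    have h2 : τ' t ∈ e.source := e.mem_source.2 (by rwa [h])
    refine e.injOn h2 (he _ h1 _).1 ?_
    change e (τ' t) = e (_ • τ t)
    rw [(he _ h1 _).2]
    refine Prod.ext ?_ ?_
    · rw [e.coe_fst h1, e.coe_fst h2, h]
    · simp
  have hex : ∀ t, ∃ u : Circle, τ' t = u • τ t := by
    intro t
    obtain ⟨e, he, h'⟩ := hπ.exists_trivialization (π (τ t))
    exact ⟨_, hloc e h' t he⟩
  -- The pointwise choice is forced because the action is free. Hence `g` agrees locally with the
  -- quotient of the fibre coordinates, which is continuous.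
  choose g hg using hex
  refine ⟨⟨g, ?_⟩, hg⟩
  rw [continuous_iff_continuousAt]
  intro t
  obtain ⟨e, he, h'⟩ := hπ.exists_trivialization (π (τ t))
  have h1 : τ t ∈ e.source := e.mem_source.2 he
  have h2 : τ' t ∈ e.source := e.mem_source.2 (by rwa [h])
  have hc : ContinuousAt (fun t => (e (τ' t)).2 * (e (τ t)).2⁻¹) t := by
    have c1 : ContinuousAt (fun t => e (τ t)) t :=
      (e.continuousAt h1).comp τ.continuous.continuousAt
    have c2 : ContinuousAt (fun t => e (τ' t)) t :=
      (e.continuousAt h2).comp τ'.continuous.continuousAt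
    exact c2.snd.mul c1.snd.inv
  refine hc.congr ?_
  filter_upwards [τ.continuous.continuousAt.preimage_mem_nhds (e.open_source.mem_nhds h1)] with s hs
  exact hπ.smul_left_injective ((hloc e h' s (e.mem_source.1 hs)).symm.trans (hg s))

/-- A map into a fibre is given by an angle function. -/
lemma exists_angle {T : Type*} [TopologicalSpace T] [SimplyConnectedSpace T]
    [LocallyPathConnectedSpace T] (τ : C(T, P)) (y : P) (h : ∀ t, π (τ t) = π y) (t₀ : T)
    {θ : ℝ} (hθ : τ t₀ = Circle.exp (2 * Real.pi * θ) • y) :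
    ∃ G : C(T, ℝ), G t₀ = θ ∧ ∀ t, τ t = Circle.exp (2 * Real.pi * G t) • y := by
  obtain ⟨g, hg⟩ := hπ.exists_div (.const T y) τ h
  obtain ⟨G, hG0, hG⟩ := CircleBundle.exists_angle g t₀ (θ := θ)
    (hπ.smul_left_injective (y := y) ((hg t₀).symm.trans hθ))
  refine ⟨G, hG0, fun t => ?_⟩
  rw [hg, hG]
  rfl

/-- The value of an obstruction cochain may be computed with any lift. -/
lemma obstruction_apply {c : SingularCochain 2 X} {ℓ : SingularSimplex 1 X → SingularSimplex 1 P}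
    {σ : SingularSimplex 2 X}
    (hc : ∃ (τ : SingularSimplex 2 P) (f : Fin 3 → SingularSimplex 1 ℝ),
      (∀ t, π (τ t) = σ t) ∧
      (∀ i t, ℓ (face i σ) t = Circle.exp (2 * Real.pi * f i t) • face i τ t) ∧
      (c σ : ℝ) = ∑ i : Fin 3, (-1) ^ (i : ℕ) *
        (f i (stdSimplex.vertex 1) - f i (stdSimplex.vertex 0)))
    {τ : SingularSimplex 2 P} (hτ : ∀ t, π (τ t) = σ t) {f : Fin 3 → SingularSimplex 1 ℝ}
    (hf : ∀ i t, ℓ (face i σ) t = Circle.exp (2 * Real.pi * f i t) • face i τ t) :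
    (c σ : ℝ) = ∑ i : Fin 3, (-1) ^ (i : ℕ) * increment (f i) := by
  obtain ⟨τ', f', hτ', hf', hc⟩ := hc
  obtain ⟨g, hg⟩ := hπ.exists_div τ τ' fun t => by rw [hτ, hτ']
  obtain ⟨θ, hθ⟩ := exists_exp_eq (g (stdSimplex.vertex 0))
  obtain ⟨G, -, hG⟩ := CircleBundle.exists_angle g _ hθ
  -- Passing from `τ` to `τ'` turns the lift by an angle function `G` on the whole simplex, so each
  -- `f i` changes by a face of `G`, and the increments of these faces cancel around the boundary.
  have key : ∀ i, increment (f i) = increment (f' i) + increment (face i G) := by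
    intro i
    have : increment (f i) = increment (f' i + face i G) := by
      refine increment_eq_of_exp_eq fun t => hπ.smul_left_injective (y := face i τ t) ?_
      rw [← hf, hf']
      have h1 : face i τ' t = Circle.exp (2 * Real.pi * face i G t) • face i τ t := by
        rw [← show _ = Circle.exp (2 * Real.pi * face i G t) from hG _]
        exact hg _
      rw [h1, smul_smul, ← Circle.exp_add, ← mul_add]
      rfl
    rw [this]
    simp only [increment, ContinuousMap.add_apply]
    ring
  simp only [key, mul_add, Finset.sum_add_distrib, sum_increment_face, add_zero]
  exact hc

/-- The Euler class evaluates on a sphere to the negative of the winding number of the boundary of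
any lift. -/
lemma evalSphere_eulerClass {x : H2 X} (hx : IsEulerClass π x) {σ : SingularSimplex 2 X} {y : P}
    (hσ : ∀ i, face i σ = .const _ (π y)) {τ : SingularSimplex 2 P} (hτ : ∀ t, π (τ t) = σ t)
    {a : Fin 3 → SingularSimplex 1 ℝ}
    (ha : ∀ i t, face i τ t = Circle.exp (2 * Real.pi * a i t) • y) :
    (evalSphere σ (π y) hσ x : ℝ) = -∑ i : Fin 3, (-1) ^ (i : ℕ) * increment (a i) := by
  obtain ⟨c, ⟨s, ℓ, hs, hℓ, -, hc⟩, rfl⟩ := hx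
  -- Over the constant edge `ℓ` may still move in the fibre, with some angle `b`. The same `b`
  -- enters the values on `σ` and on the constant simplex, and cancels in their difference.
  obtain ⟨g, hg⟩ := hπ.exists_div (.const _ y) (ℓ (.const _ (π y))) fun t => hℓ _ t
  obtain ⟨θ, hθ⟩ := exists_exp_eq (g (stdSimplex.vertex 0))
  obtain ⟨b, -, hb⟩ := CircleBundle.exists_angle g _ hθ
  have hℓb : ∀ t, ℓ (.const _ (π y)) t = Circle.exp (2 * Real.pi * b t) • y := fun t => by
    rw [hg, hb]
    rfl
  have h1 := hπ.obstruction_apply (hc σ) hτ (f := fun i => b - a i) fun i t => by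
    rw [hσ, ha, hℓb, smul_smul, ← Circle.exp_add, ← mul_add, ContinuousMap.sub_apply,
      sub_add_cancel]
  have h2 := hπ.obstruction_apply (hc (.const _ (π y))) (τ := .const _ y) (fun _ => rfl)
    (f := fun _ => b) fun i t => hℓb t
  rw [evalSphere_mk, Int.cast_sub, h1, h2]
  simp only [Fin.sum_univ_three, increment, ContinuousMap.sub_apply]
  ring

end IsPrincipalCircleBundle

end

end CircleBundle

/-- A path connected space is simply connected if the loops at one point are null-homotopic. -/
lemma simplyConnectedSpace_of_loops {X : Type*} [TopologicalSpace X] [PathConnectedSpace X] (x : X)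
    (h : ∀ γ : Path x x, γ.Homotopic (Path.refl x)) : SimplyConnectedSpace X := by
  rw [simply_connected_iff_loops_nullhomotopic]
  refine ⟨inferInstance, fun y γ => ?_⟩
  let α := PathConnectedSpace.somePath x y
  have h1 := Path.Homotopic.Quotient.eq.2 (h ((α.trans γ).trans α.symm))
  rw [← Path.Homotopic.Quotient.eq]
  simp only [Path.Homotopic.Quotient.mk_trans, Path.Homotopic.Quotient.mk_symm,
    Path.Homotopic.Quotient.mk_refl] at h1 ⊢
  set a := Path.Homotopic.Quotient.mk α
  set g := Path.Homotopic.Quotient.mk γ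
  calc g = (a.symm.trans ((a.trans g).trans a.symm)).trans a := by
        simp [Path.Homotopic.Quotient.trans_assoc,
          ← Path.Homotopic.Quotient.trans_assoc a.symm a]
    _ = .refl y := by rw [h1]; simp

/-! ### The fundamental group of a circle bundle -/

namespace CircleBundle

noncomputable section

/-- The parametrization of the standard `1`-simplex by the unit interval. -/
def line : C(unitInterval, stdSimplex ℝ (Fin 2)) where
  toFun t := ⟨![1 - t, t], by
    refine ⟨fun i => ?_, by simp⟩
    fin_cases i
    · exact sub_nonneg.2 t.2.2
    · exact t.2.1⟩
  continuous_toFun := by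
    refine Continuous.subtype_mk (continuous_pi fun i => ?_) _
    fin_cases i
    · exact continuous_const.sub continuous_subtype_val
    · exact continuous_subtype_val

lemma line_zero : line 0 = stdSimplex.vertex 0 := by
  ext i
  fin_cases i
  · change 1 - ((0 : unitInterval) : ℝ) = _
    simp
  · change ((0 : unitInterval) : ℝ) = _
    simp

lemma line_one : line 1 = stdSimplex.vertex 1 := by
  ext i
  fin_cases i
  · change 1 - ((1 : unitInterval) : ℝ) = _
    simp
  · change ((1 : unitInterval) : ℝ) = _
    simp

lemma line_surjective : Function.Surjective line := by
  intro t
  have h := stdSimplex.add_eq_one t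
  refine ⟨⟨t 1, t.2.1 1, stdSimplex.le_one t 1⟩, ?_⟩
  ext i
  fin_cases i
  · change 1 - t 1 = t 0
    linarith
  · rfl

/-- The edge from the `i`-th to the `j`-th vertex of the standard `2`-simplex. -/
def edge (i j : Fin 3) :
    Path (stdSimplex.vertex (S := ℝ) i) (stdSimplex.vertex (S := ℝ) j) where
  toFun t := stdSimplex.map ![i, j] (line t)
  continuous_toFun := (stdSimplex.continuous_map _).comp line.continuous
  source' := by rw [line_zero, map_vertex]; rfl
  target' := by rw [line_one, map_vertex]; rfl

variable {P X : Type*} [TopologicalSpace P] [TopologicalSpace X]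

lemma face_zero_line (τ : SingularSimplex 2 X) (t : unitInterval) : face 0 τ (line t) = τ (edge 1 2 t) := by
  change τ (stdSimplex.map (Fin.succAbove 0) (line t)) = τ (stdSimplex.map ![1, 2] (line t))
  rw [show (Fin.succAbove 0 : Fin 2 → Fin 3) = ![1, 2] by decide]

lemma face_one_line (τ : SingularSimplex 2 X) (t : unitInterval) : face 1 τ (line t) = τ (edge 0 2 t) := by
  change τ (stdSimplex.map (Fin.succAbove 1) (line t)) = τ (stdSimplex.map ![0, 2] (line t))
  rw [show (Fin.succAbove 1 : Fin 2 → Fin 3) = ![0, 2] by decide]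

lemma face_two_line (τ : SingularSimplex 2 X) (t : unitInterval) : face 2 τ (line t) = τ (edge 0 1 t) := by
  change τ (stdSimplex.map (Fin.succAbove 2) (line t)) = τ (stdSimplex.map ![0, 1] (line t))
  rw [show (Fin.succAbove 2 : Fin 2 → Fin 3) = ![0, 1] by decide]

/-- A `2`-simplex that maps its last edges to a point, built from a null-homotopy of a loop. -/
lemma exists_simplex_of_homotopy {x : X} {γ : Path x x} (h : γ.Homotopic (Path.refl x)) :
    ∃ σ : SingularSimplex 2 X, (∀ t, σ (edge 0 1 t) = γ t) ∧ (∀ t, σ (edge 0 2 t) = x) ∧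
      ∀ t, σ (edge 1 2 t) = x := by
  obtain ⟨H⟩ := h
  have h01 : ∀ t : stdSimplex ℝ (Fin 3), t 0 + t 1 + t 2 = 1 := fun t => by
    have := stdSimplex.sum_eq_one t
    rwa [Fin.sum_univ_three] at this
  have hd : ∀ t : stdSimplex ℝ (Fin 3), 0 < max (1 - t 2) (1 / 2) := fun t => by positivity
  have hc : ∀ i, Continuous fun t : stdSimplex ℝ (Fin 3) => t i := fun i =>
    (continuous_apply i).comp continuous_subtype_val
  -- The loop parameter is t₁ / (1 - t₂), which is undefined at the last vertex. The homotopy is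
  -- therefore run at double speed: for t₂ ≥ 1/2 it has already reached the constant loop, and the
  -- denominator can be replaced by its maximum with 1/2.
  let q : C(stdSimplex ℝ (Fin 3), unitInterval × unitInterval) :=
    ⟨fun t => (⟨min 1 (2 * t 2), le_min zero_le_one (mul_nonneg zero_le_two (t.2.1 2)),
      min_le_left _ _⟩, ⟨t 1 / max (1 - t 2) (1 / 2), div_nonneg (t.2.1 1) (hd t).le, by
        rw [div_le_one (hd t)]
        have h0 : 0 ≤ t 0 := t.2.1 0
        exact le_max_of_le_left (by linarith [h01 t])⟩), by
      refine Continuous.prodMk (Continuous.subtype_mk ?_ _) (Continuous.subtype_mk ?_ _)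
      · exact continuous_const.min (continuous_const.mul (hc 2))
      · exact (hc 1).div ((continuous_const.sub (hc 2)).max continuous_const) fun t => (hd t).ne'⟩
  have hcoord : ∀ i j k t, (edge i j t : stdSimplex ℝ (Fin 3)) k =
      (if i = k then 1 - (t : ℝ) else 0) + if j = k then (t : ℝ) else 0 := by
    intro i j k t
    change stdSimplex.map ![i, j] (line t) k = _
    rw [stdSimplex.map_coe, FunOnFinite.linearMap_apply_apply]
    simp [Finset.sum_filter, line]
    rfl
  refine ⟨⟨fun t => H (q t), by fun_prop⟩, fun t => ?_, fun t => ?_, fun t => ?_⟩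
  · have : q (edge 0 1 t) = (0, t) := by
      refine Prod.ext (Subtype.ext ?_) (Subtype.ext ?_)
      · simp [q, hcoord]
      · simp [q, hcoord]
        norm_num
    change H (q (edge 0 1 t)) = γ t
    rw [this, H.apply_zero]
    rfl
  · have : (q (edge 0 2 t)).2 = 0 := by
      refine Subtype.ext ?_
      simp [q, hcoord]
    change H ((q (edge 0 2 t)).1, (q (edge 0 2 t)).2) = x
    rw [this, H.source]
  · change H ((q (edge 1 2 t)).1, (q (edge 1 2 t)).2) = x
    obtain ht | ht := le_total (t : ℝ) (1 / 2)
    · have : (q (edge 1 2 t)).2 = 1 := by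
        refine Subtype.ext ?_
        have v1 : (edge 1 2 t : stdSimplex ℝ (Fin 3)) 1 = 1 - t := by simp [hcoord]
        have v2 : (edge 1 2 t : stdSimplex ℝ (Fin 3)) 2 = t := by simp [hcoord]
        change edge 1 2 t 1 / max (1 - edge 1 2 t 2) (1 / 2) = 1
        rw [v1, v2, max_eq_left (by linarith), div_self (by linarith)]
      rw [this, H.target]
    · have : (q (edge 1 2 t)).1 = 1 := by
        refine Subtype.ext ?_
        simp [q, hcoord]
        linarith
      rw [this, H.apply_one]
      rfl

lemma edge_homotopic (τ : SingularSimplex 2 X) :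
    (((edge 0 1).map τ.continuous).trans ((edge 1 2).map τ.continuous)).Homotopic
      ((edge 0 2).map τ.continuous) := by
  rw [← Path.map_trans]
  exact (SimplyConnectedSpace.paths_homotopic _ _).map τ

/-- The segment as a path. -/
def segmentPath (a b : ℝ) : Path a b where
  toFun t := a + t * (b - a)
  source' := by simp
  target' := by simp

namespace IsPrincipalCircleBundle

variable [MulAction Circle P] {π : P → X} (hπ : IsPrincipalCircleBundle π)

/-- The orbit of a point, parametrized by the angle. -/
def orbit (y : P) : C(ℝ, P) where
  toFun r := Circle.exp (2 * Real.pi * r) • y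
  continuous_toFun :=
    hπ.continuous_smul.comp (Continuous.prodMk (by fun_prop) continuous_const)

lemma orbit_intCast (y : P) (n : ℤ) : hπ.orbit y n = y := by
  change Circle.exp (2 * Real.pi * n) • y = y
  rw [Circle.exp_two_pi_mul_int, one_smul]

lemma orbit_zero (y : P) : hπ.orbit y 0 = y := by
  simpa using hπ.orbit_intCast y 0

lemma orbit_add_intCast (y : P) (r : ℝ) (n : ℤ) : hπ.orbit y (r + n) = hπ.orbit y r := by
  change Circle.exp (2 * Real.pi * (r + n)) • y = Circle.exp (2 * Real.pi * r) • y
  rw [mul_add, Circle.exp_add, Circle.exp_two_pi_mul_int, mul_one]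

/-- The loop that runs through an orbit `n` times. -/
def orbitLoop (y : P) (n : ℤ) : Path y y :=
  ((segmentPath 0 n).map (hπ.orbit y).continuous).cast (hπ.orbit_zero y).symm
    (hπ.orbit_intCast y n).symm

/-- Since ℝ is simply connected, the homotopy class of a loop in an orbit depends only on the final
value of its angle function. -/
lemma homotopic_orbitLoop {y : P} {n : ℤ} (δ : Path y y) (B : Path (0 : ℝ) n)
    (h : ∀ t, δ t = hπ.orbit y (B t)) : δ.Homotopic (hπ.orbitLoop y n) := by
  have : δ = (B.map (hπ.orbit y).continuous).cast (hπ.orbit_zero y).symm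
    (hπ.orbit_intCast y n).symm := Path.ext (funext h)
  rw [this]
  exact ((SimplyConnectedSpace.paths_homotopic B (segmentPath 0 n)).map (hπ.orbit y)).pathCast _ _

lemma orbitLoop_zero (y : P) : hπ.orbitLoop y 0 = Path.refl y := by
  ext t
  change hπ.orbit y (0 + t * (((0 : ℤ) : ℝ) - 0)) = y
  simpa using hπ.orbit_zero y

lemma orbitLoop_add (y : P) (m n : ℤ) :
    ((hπ.orbitLoop y m).trans (hπ.orbitLoop y n)).Homotopic (hπ.orbitLoop y (m + n)) := by
  refine hπ.homotopic_orbitLoop _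
    (((segmentPath 0 m).trans (segmentPath m (m + n))).cast rfl (by push_cast; rfl)) fun t => ?_
  rw [Path.cast_coe, Path.trans_apply, Path.trans_apply]
  split_ifs
  · rfl
  -- The angle of the second loop continues from `m` instead of 0; an integer shift is invisible in
  -- the orbit.
  · change hπ.orbit y (0 + _ * ((n : ℝ) - 0)) = hπ.orbit y ((m : ℝ) + _ * ((m : ℝ) + n - m))
    rw [add_comm (m : ℝ), orbit_add_intCast]
    congr 1
    ring

/-- If the generator of the fundamental group of an orbit is null-homotopic, then so are all its
multiples. -/
lemma orbitLoop_homotopic_refl {y : P} {w : ℤ} (hw : w = 1 ∨ w = -1)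
    (h : (hπ.orbitLoop y w).Homotopic (Path.refl y)) (n : ℤ) :
    (hπ.orbitLoop y n).Homotopic (Path.refl y) := by
  let f : ℤ → Path.Homotopic.Quotient y y := fun n => .mk (hπ.orbitLoop y n)
  have hadd : ∀ m n, f (m + n) = (f m).trans (f n) := fun m n =>
    (Path.Homotopic.Quotient.eq.2 (hπ.orbitLoop_add y m n)).symm
  have h0 : f 0 = .refl y := congrArg Path.Homotopic.Quotient.mk (hπ.orbitLoop_zero y)
  have hw' : f w = .refl y := Path.Homotopic.Quotient.eq.2 h
  have hneg : f (-w) = .refl y := by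
    have := hadd w (-w)
    rw [add_neg_cancel, h0, hw', Path.Homotopic.Quotient.refl_trans] at this
    exact this.symm
  have h1 : f 1 = .refl y := by
    obtain rfl | rfl := hw
    · exact hw'
    · simpa using hneg
  have h2 : f (-1) = .refl y := by
    obtain rfl | rfl := hw
    · exact hneg
    · exact hw'
  refine Path.Homotopic.Quotient.eq.1 (show f n = .refl y from ?_)
  induction n using Int.induction_on with
  | zero => exact h0
  | succ n ih => rw [hadd, ih, h1, Path.Homotopic.Quotient.refl_trans]
  | pred n ih => rw [sub_eq_add_neg, hadd, ih, h2, Path.Homotopic.Quotient.refl_trans]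

include hπ

lemma continuous : Continuous π := by
  rw [continuous_iff_continuousAt]
  intro y
  obtain ⟨e, he, -⟩ := hπ.exists_trivialization (π y)
  exact e.continuousAt_proj (e.mem_source.2 he)

lemma joined_of_proj_eq {y z : P} (h : π y = π z) : Joined y z := by
  obtain ⟨g, hg⟩ := hπ.exists_div (.const Unit z) (.const Unit y) fun _ => h
  obtain ⟨θ, hθ⟩ := exists_exp_eq (g ())
  have h1 : y = hπ.orbit z θ := by
    refine (hg ()).trans ?_
    rw [hθ]
    rfl
  refine ⟨((segmentPath θ 0).map (hπ.orbit z).continuous).cast h1 (hπ.orbit_zero z).symm⟩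

/-- A path of the base is read as a 2-simplex that depends on t₂ only, so that lifts of 2-simplices
also lift paths. The ends of the lift are then moved within their fibres. -/
lemma pathConnectedSpace [PathConnectedSpace X]
    (hlift : ∀ σ : SingularSimplex 2 X, ∃ τ : SingularSimplex 2 P, ∀ t, π (τ t) = σ t)
    [Nonempty P] : PathConnectedSpace P := by
  refine ⟨inferInstance, fun y z => ?_⟩
  let p := PathConnectedSpace.somePath (π y) (π z)
  obtain ⟨τ, hτ⟩ := hlift ⟨fun t => p.extend (t 2), p.continuous_extend.comp
    ((continuous_apply 2).comp continuous_subtype_val)⟩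
  have h0 : π y = π (τ (stdSimplex.vertex 0)) := by
    rw [hτ]
    simp
  have h2 : π (τ (stdSimplex.vertex 2)) = π z := by
    rw [hτ]
    simp
  exact ((hπ.joined_of_proj_eq h0).trans
    ((PathConnectedSpace.joined _ _).map τ.continuous)).trans (hπ.joined_of_proj_eq h2)

/-- A loop in a fibre which bounds a lift of a sphere is null-homotopic, and its winding number
is the value of the Euler class on the sphere. -/
lemma exists_orbitLoop_homotopic_refl {x : H2 X} (hx : IsEulerClass π x)
    {σ : SingularSimplex 2 X} {x₀ : X} (hσ : ∀ i, face i σ = .const _ x₀) :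
    ∃ (y : P) (w : ℤ), π y = x₀ ∧ evalSphere σ x₀ hσ x = -w ∧
      (hπ.orbitLoop y w).Homotopic (Path.refl y) := by
  obtain ⟨τ, hτ⟩ : ∃ τ : SingularSimplex 2 P, ∀ t, π (τ t) = σ t := by
    obtain ⟨c, ⟨s, ℓ, -, -, -, hc⟩, -⟩ := hx
    obtain ⟨τ, -, hτ, -⟩ := hc σ
    exact ⟨τ, hτ⟩
  have hface : ∀ i t, π (face i τ t) = x₀ := fun i t => by
    have := DFunLike.congr_fun (hσ i) t
    exact (hτ _).trans this
  set y := τ (stdSimplex.vertex 0) with hy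
  have s20 : face 2 τ (stdSimplex.vertex 0) = y := face_vertex _ _ _
  have s21 : face 2 τ (stdSimplex.vertex 1) = τ (stdSimplex.vertex 1) := face_vertex _ _ _
  have s00 : face 0 τ (stdSimplex.vertex 0) = τ (stdSimplex.vertex 1) := face_vertex _ _ _
  have s01 : face 0 τ (stdSimplex.vertex 1) = τ (stdSimplex.vertex 2) := face_vertex _ _ _
  have s10 : face 1 τ (stdSimplex.vertex 0) = y := face_vertex _ _ _
  have s11 : face 1 τ (stdSimplex.vertex 1) = τ (stdSimplex.vertex 2) := face_vertex _ _ _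
  have hy0 : π y = x₀ := by rw [← s20, hface]
  subst hy0
  -- The angle is continued along the edges 01 and 12, and separately along 02 from the same start.
  -- At the last vertex the two results differ by the integer `w`, the winding number of the
  -- boundary.
  obtain ⟨a₂, h20, h2⟩ := hπ.exists_angle (face 2 τ) y (hface 2) (stdSimplex.vertex 0) (θ := 0)
    (by simpa using s20)
  obtain ⟨a₀, h00, h0⟩ := hπ.exists_angle (face 0 τ) y (hface 0) (stdSimplex.vertex 0)
    (θ := a₂ (stdSimplex.vertex 1)) (by rw [s00, ← s21, h2])
  obtain ⟨a₁, h10, h1⟩ := hπ.exists_angle (face 1 τ) y (hface 1) (stdSimplex.vertex 0) (θ := 0)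
    (by simpa using s10)
  obtain ⟨w, hw⟩ : ∃ w : ℤ, a₀ (stdSimplex.vertex 1) = a₁ (stdSimplex.vertex 1) + w := by
    refine exp_eq_iff.1 (hπ.smul_left_injective (y := y) ?_)
    rw [← h0, ← h1, s01, s11]
  refine ⟨y, w, rfl, ?_, ?_⟩
  · have := hπ.evalSphere_eulerClass hx hσ hτ (a := ![a₀, a₁, a₂]) fun i t => by
      fin_cases i
      · exact h0 t
      · exact h1 t
      · exact h2 t
    have h3 : (evalSphere σ (π y) hσ x : ℝ) = -w := by
      rw [this, Fin.sum_univ_three]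
      simp [increment, hw, h20, h10, h00]
      ring
    exact_mod_cast h3
  · let A₂ : Path (0 : ℝ) (a₂ (stdSimplex.vertex 1)) :=
      { toFun := fun t => a₂ (line t), source' := by rw [line_zero, h20],
        target' := by rw [line_one] }
    let A₀ : Path (a₂ (stdSimplex.vertex 1)) (a₀ (stdSimplex.vertex 1)) :=
      { toFun := fun t => a₀ (line t), source' := by rw [line_zero, h00],
        target' := by rw [line_one] }
    -- The edge 02 is run backwards; its angle is shifted by `w` to join onto the end of `A₀`, so
    -- the total angle goes from 0 to `w`.
    let A₁ : Path (a₀ (stdSimplex.vertex 1)) w :=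
      { toFun := fun t => a₁ (line (unitInterval.symm t)) + w, source' := by simp [line_one, hw],
        target' := by simp [line_zero, h10] }
    have key := hπ.homotopic_orbitLoop ((((edge 0 1).map τ.continuous).trans
      ((edge 1 2).map τ.continuous)).trans ((edge 0 2).map τ.continuous).symm)
      ((A₂.trans A₀).trans A₁) fun t => by
        simp only [Path.trans_apply]
        split_ifs
        · exact (face_two_line τ _).symm.trans (h2 _)
        · exact (face_zero_line τ _).symm.trans (h0 _)
        · refine ((face_one_line τ _).symm.trans (h1 _)).trans ?_
          exact (hπ.orbit_add_intCast y _ w).symm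
    refine key.symm.trans ?_
    rw [← Path.Homotopic.Quotient.eq]
    have := Path.Homotopic.Quotient.eq.2 (edge_homotopic τ)
    simp only [Path.Homotopic.Quotient.mk_trans, Path.Homotopic.Quotient.mk_symm] at this ⊢
    rw [this, Path.Homotopic.Quotient.trans_symm]
    rfl

/-- A principal circle bundle over a simply connected space whose Euler class takes the value one
on some sphere has a simply connected total space. -/
theorem simplyConnectedSpace [SimplyConnectedSpace X] {x : H2 X} (hx : IsEulerClass π x)
    {σ : SingularSimplex 2 X} {x₀ : X} (hσ : ∀ i, face i σ = .const _ x₀)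
    (h : evalSphere σ x₀ hσ x = 1 ∨ evalSphere σ x₀ hσ x = -1) : SimplyConnectedSpace P := by
  have hlift : ∀ σ : SingularSimplex 2 X, ∃ τ : SingularSimplex 2 P, ∀ t, π (τ t) = σ t := by
    obtain ⟨c, ⟨s, ℓ, -, -, -, hc⟩, -⟩ := hx
    intro σ
    obtain ⟨τ, -, hτ, -⟩ := hc σ
    exact ⟨τ, hτ⟩
  -- The lifted sphere contracts an orbit loop that runs once around the fibre through `y`. It
  -- remains to push every loop at `y` into this fibre.
  obtain ⟨y, w, -, hw, hnull⟩ := hπ.exists_orbitLoop_homotopic_refl hx hσ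
  have hw' : w = 1 ∨ w = -1 := by omega
  have : Nonempty P := ⟨y⟩
  have := hπ.pathConnectedSpace hlift
  refine simplyConnectedSpace_of_loops y fun γ => ?_
  obtain ⟨σ', h01, h02, h12⟩ := exists_simplex_of_homotopy
    (SimplyConnectedSpace.paths_homotopic (γ.map hπ.continuous) (Path.refl (π y)))
  obtain ⟨τ₀, hτ₀⟩ := hlift σ'
  let γ' : SingularSimplex 1 P := ⟨fun t => γ.extend (t 1), γ.continuous_extend.comp
    ((continuous_apply 1).comp continuous_subtype_val)⟩
  have hγ' : ∀ t, γ' (line t) = γ t := fun t => by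
    change γ.extend ((t : ℝ)) = γ t
    simp
  obtain ⟨g, hg⟩ := hπ.exists_div (face 2 τ₀) γ' fun t => by
    obtain ⟨s, rfl⟩ := line_surjective t
    rw [hγ', face_two_line, hτ₀, h01]
    rfl
  -- The lift `τ₀` need not restrict to γ on the edge 01. The correction `g` on that edge is
  -- extended over the simplex by the projection that sends the last vertex to vertex 1.
  let ρ : C(stdSimplex ℝ (Fin 3), stdSimplex ℝ (Fin 2)) :=
    ⟨stdSimplex.map ![0, 1, 1], stdSimplex.continuous_map _⟩
  let τ : SingularSimplex 2 P := ⟨fun t => g (ρ t) • τ₀ t,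
    hπ.continuous_smul.comp ((g.comp ρ).continuous.prodMk τ₀.continuous)⟩
  have hτ : ∀ t, π (τ t) = σ' t := fun t => (hπ.proj_smul _ _).trans (hτ₀ t)
  have hρ : ∀ t, ρ (edge 0 1 t) = line t := by
    intro t
    change stdSimplex.map ![0, 1, 1] (stdSimplex.map ![0, 1] (line t)) = line t
    rw [stdSimplex.map_comp_apply]
    convert stdSimplex.map_id_apply (line t) using 2
    decide
  have hτγ : ∀ t, τ (edge 0 1 t) = γ t := by
    intro t
    rw [← hγ', hg]
    change g (ρ (edge 0 1 t)) • τ₀ (edge 0 1 t) = _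
    rw [hρ, face_two_line]
  have e0 : y = τ (stdSimplex.vertex 0) := by simpa using (hτγ 0).symm
  have e1 : y = τ (stdSimplex.vertex 1) := by simpa using (hτγ 1).symm
  -- The other two edges lie over a single point, so γ, the edge 01 of `τ`, is homotopic to a loop
  -- in the fibre.
  let δ : Path y y := (((edge 0 2).map τ.continuous).trans
    ((edge 1 2).map τ.continuous).symm).cast e0 e1
  have hγδ : γ.Homotopic δ := by
    have h1 : γ = ((edge 0 1).map τ.continuous).cast e0 e1 := Path.ext (funext fun t => (hτγ t).symm)
    rw [h1]
    refine Path.Homotopic.pathCast ?_ _ _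
    have := Path.Homotopic.Quotient.eq.2 (edge_homotopic τ)
    rw [← Path.Homotopic.Quotient.eq]
    simp only [Path.Homotopic.Quotient.mk_trans, Path.Homotopic.Quotient.mk_symm] at this ⊢
    rw [← this]
    simp
  have hδ : ∀ t, π (δ t) = π y := by
    intro t
    change π ((((edge 0 2).map τ.continuous).trans ((edge 1 2).map τ.continuous).symm) t) = π y
    rw [Path.trans_apply]
    split_ifs
    · exact (hτ _).trans (h02 _)
    · exact (hτ _).trans (h12 _)
  obtain ⟨G, hG0, hG⟩ := hπ.exists_angle δ.toContinuousMap y hδ 0 (θ := 0) (by simp)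
  obtain ⟨m, hm⟩ : ∃ m : ℤ, G 1 = 0 + m := by
    refine exp_eq_iff.1 (hπ.smul_left_injective (y := y) ?_)
    rw [← hG]
    simp
  rw [zero_add] at hm
  exact hγδ.trans ((hπ.homotopic_orbitLoop δ ⟨G, hG0, hm⟩ hG).trans
    (hπ.orbitLoop_homotopic_refl hw' hnull m))

end IsPrincipalCircleBundle

end

end CircleBundle

namespace CircleBundle

noncomputable section

/-! ### A sphere glued from two trivializations -/

section Clutching

/-- A primitive third root of unity. -/
def omega : ℂ := ⟨-1 / 2, Real.sqrt 3 / 2⟩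

lemma omega_mul_omega : omega * omega = ⟨-1 / 2, -(Real.sqrt 3 / 2)⟩ := by
  have h : Real.sqrt 3 * Real.sqrt 3 = 3 := Real.mul_self_sqrt (by norm_num)
  apply Complex.ext
  · simp [omega]
    linarith
  · simp [omega]
    ring

lemma omega_cube : omega * omega * omega = 1 := by
  have h : Real.sqrt 3 * Real.sqrt 3 = 3 := Real.mul_self_sqrt (by norm_num)
  rw [omega_mul_omega]
  apply Complex.ext
  · simp [omega]
    linarith
  · simp [omega]
    ring

lemma conj_omega : (starRingEnd ℂ) omega = omega * omega := by
  rw [omega_mul_omega]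
  apply Complex.ext <;> simp [omega]

lemma arg_omega : omega.arg = 2 * Real.pi / 3 := by
  have h : omega = Real.cos (2 * Real.pi / 3) + Real.sin (2 * Real.pi / 3) * Complex.I := by
    rw [show 2 * Real.pi / 3 = Real.pi - Real.pi / 3 by ring, Real.cos_pi_sub, Real.sin_pi_sub,
      Real.cos_pi_div_three, Real.sin_pi_div_three]
    apply Complex.ext
    · simp [omega]
      norm_num
    · simp [omega]
  rw [h, Complex.ofReal_cos, Complex.ofReal_sin]
  refine Complex.arg_cos_add_sin_mul_I ⟨?_, ?_⟩ <;> linarith [Real.pi_pos]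

lemma phase_of_pos {a : ℝ} (ha : 0 < a) : phase a = 1 := by
  rw [phase, Complex.arg_ofReal_of_nonneg ha.le, Circle.exp_zero]

lemma phase_inv {z : ℂ} (hz : z ≠ 0) : phase z⁻¹ = (phase z)⁻¹ := by
  rw [eq_inv_iff_mul_eq_one, ← phase_mul (inv_ne_zero hz) hz, inv_mul_cancel₀ hz, phase_one]

lemma phase_conj {z : ℂ} (hz : z ≠ 0) : phase ((starRingEnd ℂ) z) = (phase z)⁻¹ := by
  have h : (starRingEnd ℂ) z ≠ 0 := (map_ne_zero _).2 hz
  rw [eq_inv_iff_mul_eq_one, ← phase_mul h hz, mul_comm, Complex.mul_conj]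
  exact phase_of_pos (Complex.normSq_pos.2 hz)

/-- A function on the `2`-simplex that vanishes exactly on the boundary. -/
def bump : C(stdSimplex ℝ (Fin 3), ℝ) where
  toFun t := t 0 * t 1 * t 2
  continuous_toFun := by
    have h : ∀ i, Continuous fun t : stdSimplex ℝ (Fin 3) => t i := fun i =>
      (continuous_apply i).comp continuous_subtype_val
    exact ((h 0).mul (h 1)).mul (h 2)

/-- The embedding of the `2`-simplex as an equilateral triangle centered at the origin. -/
def triangle : C(stdSimplex ℝ (Fin 3), ℂ) where
  toFun t := t 0 + t 1 * omega + t 2 * (omega * omega)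
  continuous_toFun := by
    have h : ∀ i, Continuous fun t : stdSimplex ℝ (Fin 3) => (t i : ℂ) := fun i =>
      Complex.continuous_ofReal.comp ((continuous_apply i).comp continuous_subtype_val)
    exact ((h 0).add ((h 1).mul continuous_const)).add ((h 2).mul continuous_const)

lemma bump_nonneg (t : stdSimplex ℝ (Fin 3)) : 0 ≤ bump t :=
  mul_nonneg (mul_nonneg (t.2.1 0) (t.2.1 1)) (t.2.1 2)

/-- The triangle meets 0 only at the barycentre, where `bump` is not zero. Hence [bump : triangle]
is a map to the projective line, and it sends the whole boundary to [0 : 1]. -/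
lemma triangle_ne_zero {t : stdSimplex ℝ (Fin 3)} (h : bump t = 0) : triangle t ≠ 0 := by
  intro h0
  have hs : t 0 + t 1 + t 2 = 1 := by
    have := stdSimplex.sum_eq_one t
    rwa [Fin.sum_univ_three] at this
  have h3 : Real.sqrt 3 ≠ 0 := by positivity
  change (t 0 : ℂ) + t 1 * omega + t 2 * (omega * omega) = 0 at h0
  rw [omega_mul_omega] at h0
  have h1 := congrArg Complex.im h0
  have h2 := congrArg Complex.re h0
  simp [omega] at h1 h2
  have h4 : t 1 = t 2 := mul_right_cancel₀ h3 (by linarith)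
  have h5 : t 0 = 1 / 3 := by linarith
  have h6 : t 1 = 1 / 3 := by linarith
  change t 0 * t 1 * t 2 = 0 at h
  rw [← h4, h5, h6] at h
  norm_num at h

lemma face_coord {k : ℕ} (i : Fin (k + 2)) (t : stdSimplex ℝ (Fin (k + 1))) (j : Fin (k + 2)) :
    stdSimplex.map i.succAbove t j = ∑ l, if i.succAbove l = j then t l else 0 := by
  rw [stdSimplex.map_coe, FunOnFinite.linearMap_apply_apply, Finset.sum_filter]

lemma bump_face (i : Fin 3) (t : stdSimplex ℝ (Fin 2)) :
    bump (stdSimplex.map i.succAbove t) = 0 := by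
  have h : stdSimplex.map i.succAbove t i = 0 := by
    rw [face_coord]
    exact Finset.sum_eq_zero fun l _ => if_neg (Fin.succAbove_ne i l)
  change stdSimplex.map i.succAbove t 0 * stdSimplex.map i.succAbove t 1 *
    stdSimplex.map i.succAbove t 2 = 0
  fin_cases i
  · simp only [Fin.zero_eta] at h ⊢
    rw [h]; ring
  · simp only [Fin.mk_one] at h ⊢
    rw [h]; ring
  · simp only [Fin.reduceFinMk] at h ⊢
    rw [h]; ring

/-- A side of the triangle. -/
def side (t : stdSimplex ℝ (Fin 2)) : ℂ := t 0 + t 1 * omega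

/-- The side runs from 1 to `omega` and lies in the upper half plane except for its start, so the
principal argument is continuous along it. -/
lemma side_mem_slitPlane (t : stdSimplex ℝ (Fin 2)) : side t ∈ Complex.slitPlane := by
  have hs := stdSimplex.add_eq_one t
  rw [Complex.mem_slitPlane_iff]
  by_cases h : t 1 = 0
  · left
    simp [side, omega, h] at hs ⊢
    linarith
  · right
    simp [side, omega, h]

lemma continuous_side : Continuous side := by
  have h : ∀ i, Continuous fun t : stdSimplex ℝ (Fin 2) => (t i : ℂ) := fun i =>
    Complex.continuous_ofReal.comp ((continuous_apply i).comp continuous_subtype_val)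
  exact (h 0).add ((h 1).mul continuous_const)

/-- By symmetry the other two sides arise from this one by rotation and by conjugation, so one
argument function serves all three. -/
lemma triangle_face (i : Fin 3) (t : stdSimplex ℝ (Fin 2)) :
    triangle (stdSimplex.map i.succAbove t) =
      ![omega * side t, (starRingEnd ℂ) (side t), side t] i := by
  have h : ∀ j, stdSimplex.map i.succAbove t j = ∑ l, if i.succAbove l = j then t l else 0 :=
    face_coord i t
  change (stdSimplex.map i.succAbove t 0 : ℂ) + stdSimplex.map i.succAbove t 1 * omega +
    stdSimplex.map i.succAbove t 2 * (omega * omega) = _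
  simp only [h, Fin.sum_univ_two]
  fin_cases i
  · simp [Fin.succAbove, side]
    ring
  · simp [Fin.succAbove, side, conj_omega]
  · simp [Fin.succAbove, side]

/-- The angle of `-1 / z` along the sides of the triangle. -/
def sideAngle (i : Fin 3) : SingularSimplex 1 ℝ where
  toFun t := ![Real.pi - 2 * Real.pi / 3 - (side t).arg, Real.pi + (side t).arg,
    Real.pi - (side t).arg] i / (2 * Real.pi)
  continuous_toFun := by
    have h : Continuous fun t => (side t).arg := continuous_iff_continuousAt.2 fun t =>
      (Complex.continuousAt_arg (side_mem_slitPlane t)).comp continuous_side.continuousAt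
    refine Continuous.div_const ?_ _
    fin_cases i
    · exact continuous_const.sub h
    · exact continuous_const.add h
    · exact continuous_const.sub h

lemma phase_neg_one : phase (-1) = Circle.exp Real.pi := by
  rw [phase, Complex.arg_neg_one]

lemma exp_sideAngle (i : Fin 3) (t : stdSimplex ℝ (Fin 2)) :
    Circle.exp (2 * Real.pi * sideAngle i t) =
      phase (-(triangle (stdSimplex.map i.succAbove t))⁻¹) := by
  have hs : side t ≠ 0 := Complex.slitPlane_ne_zero (side_mem_slitPlane t)
  have ho : omega ≠ 0 := fun h => by simpa [h] using omega_cube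
  have hc : (starRingEnd ℂ) (side t) ≠ 0 := (map_ne_zero _).2 hs
  have hn : ∀ {z : ℂ}, z ≠ 0 → phase (-z⁻¹) = Circle.exp Real.pi * (phase z)⁻¹ := fun {z} hz => by
    rw [← neg_one_mul, phase_mul (by simp) (inv_ne_zero hz), phase_inv hz, phase_neg_one]
  have hps : phase (side t) = Circle.exp (side t).arg := rfl
  have hpo : phase omega = Circle.exp (2 * Real.pi / 3) := by rw [phase, arg_omega]
  have hdiv : 2 * Real.pi * sideAngle i t = ![Real.pi - 2 * Real.pi / 3 - (side t).arg,
      Real.pi + (side t).arg, Real.pi - (side t).arg] i := mul_div_cancel₀ _ (by positivity)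
  rw [hdiv, triangle_face]
  fin_cases i
  · change Circle.exp (Real.pi - 2 * Real.pi / 3 - (side t).arg) = phase (-(omega * side t)⁻¹)
    rw [hn (mul_ne_zero ho hs), phase_mul ho hs, hps, hpo, Circle.exp_sub, Circle.exp_sub,
      div_div, div_eq_mul_inv]
  · change Circle.exp (Real.pi + (side t).arg) = phase (-((starRingEnd ℂ) (side t))⁻¹)
    rw [hn hc, phase_conj hs, hps, inv_inv, Circle.exp_add]
  · change Circle.exp (Real.pi - (side t).arg) = phase (-(side t)⁻¹)
    rw [hn hs, hps, Circle.exp_sub, div_eq_mul_inv]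

/-- The argument grows by a third of a turn along `side`, and each face, taken with its sign,
contributes -1/3: the function -1/z turns once in the negative direction. -/
lemma sum_increment_sideAngle :
    ∑ i : Fin 3, (-1 : ℝ) ^ (i : ℕ) * increment (sideAngle i) = -1 := by
  have h0 : side (stdSimplex.vertex 0) = 1 := by simp [side]
  have h1 : side (stdSimplex.vertex 1) = omega := by simp [side]
  have hpi := Real.pi_pos
  rw [Fin.sum_univ_three]
  simp [increment, sideAngle, h0, h1, arg_omega]
  field_simp
  ring

variable {ι X E : Type*} [TopologicalSpace X] [NormedAddCommGroup E] [NormedSpace ℂ E]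
  [FiniteDimensional ℂ E] (Z : VectorBundleCore ℂ X E ι)

/-- The point with given coordinates in a trivialization of the unit circle bundle. -/
def unitDetPoint (i : ι) (q : X × Circle) : (unitDet Z).TotalSpace :=
  ((unitDet Z).localTriv i).toOpenPartialHomeomorph.symm q

lemma continuousOn_unitDetPoint (i : ι) :
    ContinuousOn (unitDetPoint Z i) (Z.baseSet i ×ˢ Set.univ) :=
  ((unitDet Z).localTriv i).toOpenPartialHomeomorph.continuousOn_symm

lemma unitDetPoint_eq (i : ι) (x : X) (u : Circle) : unitDetPoint Z i (x, u) =
    (⟨x, phase (Z.coordChange i (Z.indexAt x) x).det * u⟩ : (unitDet Z).TotalSpace) := rfl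

lemma smul_unitDetPoint (i : ι) (x : X) (u v : Circle) :
    u • unitDetPoint Z i (x, v) = unitDetPoint Z i (x, u * v) :=
  congrArg (Bundle.TotalSpace.mk x)
    (mul_left_comm u (phase (Z.coordChange i (Z.indexAt x) x).det) v)

lemma unitDetPoint_coordChange {i j : ι} {x : X} (hi : x ∈ Z.baseSet i) (hj : x ∈ Z.baseSet j)
    (u : Circle) : unitDetPoint Z j (x, phase (Z.coordChange i j x).det * u) =
      unitDetPoint Z i (x, u) := by
  have hx := Z.mem_baseSet_at x
  rw [unitDetPoint_eq, unitDetPoint_eq, ← mul_assoc,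
    ← phase_mul (det_coordChange_ne_zero Z ⟨hj, hx⟩) (det_coordChange_ne_zero Z ⟨hi, hj⟩),
    det_coordChange_mul Z ⟨⟨hi, hj⟩, hx⟩]

/-- The Euler class of the unit circle bundle evaluates to one on a sphere along which the
determinants of the transition functions are `-1 / z`. -/
lemma evalSphere_eq_one_of_det {c : H2 X} (hc : IsEulerClass (unitDet Z).proj c)
    {σ : SingularSimplex 2 X} {x₀ : X} (hσ : ∀ i, face i σ = .const _ x₀) {i₁ i₂ : ι}
    (h₁ : ∀ t, bump t ≠ 0 → σ t ∈ Z.baseSet i₁) (h₂ : ∀ t, triangle t ≠ 0 → σ t ∈ Z.baseSet i₂)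
    (hdet : ∀ t, bump t ≠ 0 → triangle t ≠ 0 →
      (Z.coordChange i₁ i₂ (σ t)).det = -(bump t / triangle t)) :
    evalSphere σ x₀ hσ c = 1 := by
  have hZ := isPrincipalCircleBundle_unitDet Z
  -- The lift is the constant section 1 of the first trivialization, rewritten in the second one.
  -- There it is the phase of -(bump / triangle), which is the phase of -1 / triangle because `bump`
  -- is positive, and this expression extends continuously to the boundary.
  let τ : stdSimplex ℝ (Fin 3) → (unitDet Z).TotalSpace := fun t =>
    if bump t ≠ 0 then unitDetPoint Z i₁ (σ t, 1)
    else unitDetPoint Z i₂ (σ t, phase (-(triangle t)⁻¹))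
  have hτ₂ : ∀ t, triangle t ≠ 0 → τ t = unitDetPoint Z i₂ (σ t, phase (-(triangle t)⁻¹)) := by
    intro t ht
    by_cases hb : bump t = 0
    · exact if_neg (not_not.2 hb)
    · refine (if_pos hb).trans ?_
      rw [← unitDetPoint_coordChange Z (h₁ t hb) (h₂ t ht), hdet t hb ht, mul_one]
      congr 2
      rw [div_eq_mul_inv, ← mul_neg, phase_mul (by exact_mod_cast hb) (by simpa using ht),
        phase_of_pos ((bump_nonneg t).lt_of_ne' hb), one_mul]
  have hcont : Continuous τ := by
    rw [continuous_iff_continuousAt]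
    intro t
    by_cases hb : bump t = 0
    · have ht := triangle_ne_zero hb
      have hphase : ContinuousAt (fun s => phase (-(triangle s)⁻¹)) t := by
        refine (continuousOn_phase.continuousAt (IsOpen.mem_nhds isOpen_compl_singleton ?_)).comp ?_
        · simpa using ht
        · exact (triangle.continuous.continuousAt.inv₀ ht).neg
      have h := ((continuousOn_unitDetPoint Z i₂).continuousAt (((Z.isOpen_baseSet i₂).prod
        isOpen_univ).mem_nhds ⟨h₂ t ht, trivial⟩)).comp
        (σ.continuous.continuousAt.prodMk hphase)
      refine h.congr ?_
      filter_upwards [triangle.continuous.continuousAt.preimage_mem_nhds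
        (isOpen_compl_singleton.mem_nhds ht)] with s hs
      exact (hτ₂ s hs).symm
    · have h := ((continuousOn_unitDetPoint Z i₁).continuousAt (((Z.isOpen_baseSet i₁).prod
        isOpen_univ).mem_nhds ⟨h₁ t hb, trivial⟩)).comp
        (σ.continuous.continuousAt.prodMk (continuousAt_const (y := (1 : Circle))))
      refine h.congr ?_
      filter_upwards [bump.continuous.continuousAt.preimage_mem_nhds
        (isOpen_compl_singleton.mem_nhds hb)] with s hs
      exact (if_pos hs).symm
  have hproj : ∀ t, (unitDet Z).proj (τ t) = σ t := by
    intro t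
    simp only [τ]
    split_ifs <;> rfl
  have key := hZ.evalSphere_eulerClass hc (y := unitDetPoint Z i₂ (x₀, 1)) hσ (τ := ⟨τ, hcont⟩)
    hproj (a := sideAngle) fun i t => by
      rw [smul_unitDetPoint, mul_one, exp_sideAngle]
      refine (hτ₂ _ (triangle_ne_zero (bump_face i t))).trans ?_
      have : σ (stdSimplex.map i.succAbove t) = x₀ := DFunLike.congr_fun (hσ i) t
      rw [this]
  rw [sum_increment_sideAngle, neg_neg] at key
  exact_mod_cast key

end Clutching

end

end CircleBundle

namespace CircleBundle

noncomputable section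

/-! ### The exceptional curves -/

namespace BlowUp

variable {r : ℕ} {p : Fin r ↪ CP 2}

section

variable (p) (j : Fin r)

/-- Homogeneous coordinates of the components of the point of the exceptional curve over the
`j`-th centre which is given by the line through the centre in the direction `v`. -/
def excCoord (v : Fin 3 → ℂ) : Option (Fin r) → Fin 3 → ℂ
  | none => (p j).rep
  | some i => if i = j then v ⨯₃ (p j).rep else (p j).rep ⨯₃ (p i).rep

variable {j}

lemma excCoord_ne_zero {v : Fin 3 → ℂ} (hv : v ⨯₃ (p j).rep ≠ 0) (a : Option (Fin r)) :
    excCoord p j v a ≠ 0 := by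
  rcases a with _ | i
  · exact (p j).rep_nonzero
  · change (if i = j then _ else _) ≠ (0 : Fin 3 → ℂ)
    split_ifs with h
    · exact hv
    · exact fun h0 => h (p.injective ((eq_iff_rep _ _).2 h0)).symm

/-- A point of an exceptional curve. -/
def excPoint {v : Fin 3 → ℂ} (hv : v ⨯₃ (p j).rep ≠ 0) : BlowUp p :=
  ⟨(Projectivization.mk ℂ _ (excCoord_ne_zero p hv none),
    fun i => Projectivization.mk ℂ _ (excCoord_ne_zero p hv (some i))), fun i => by
    have h : (p j).rep ⬝ᵥ excCoord p j v (some i) = 0 ∧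
        (p i).rep ⬝ᵥ excCoord p j v (some i) = 0 := by
      simp only [excCoord]
      split_ifs with hi
      · subst hi
        exact ⟨dot_cross_self _ _, dot_cross_self _ _⟩
      · exact ⟨dot_self_cross _ _, dot_cross_self _ _⟩
    refine ⟨(Projectivization.orthogonal_mk _ _).2 h.1, ?_⟩
    rw [← (p i).mk_rep]
    exact (Projectivization.orthogonal_mk _ _).2 h.2⟩

lemma pt_excPoint {v : Fin 3 → ℂ} (hv : v ⨯₃ (p j).rep ≠ 0) (a : Option (Fin r)) :
    (excPoint p hv).pt a = Projectivization.mk ℂ _ (excCoord_ne_zero p hv a) := by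
  cases a <;> rfl

/-- Rescaling `v` does not change the line through the centre. This is what collapses the boundary
of the sphere below, where the direction is a varying multiple of `B`. -/
lemma excPoint_smul {v : Fin 3 → ℂ} (hv : v ⨯₃ (p j).rep ≠ 0) {c : ℂ}
    (hcv : (c • v) ⨯₃ (p j).rep ≠ 0) : excPoint p hcv = excPoint p hv := by
  have hc : c ≠ 0 := by
    rintro rfl
    simp at hcv
  ext a
  rw [pt_excPoint, pt_excPoint, Projectivization.mk_eq_mk_iff']
  rcases a with _ | i
  · exact ⟨1, one_smul _ _⟩
  · by_cases hi : i = j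
    · refine ⟨c, ?_⟩
      simp [excCoord, hi]
    · refine ⟨1, ?_⟩
      simp [excCoord, hi]

lemma continuous_excPoint {T : Type*} [TopologicalSpace T] {v : T → Fin 3 → ℂ} (hc : Continuous v)
    (hv : ∀ t, v t ⨯₃ (p j).rep ≠ 0) : Continuous fun t => excPoint p (hv t) := by
  have h : ∀ a, Continuous fun t =>
      (Projectivization.mk ℂ _ (excCoord_ne_zero p (hv t) a) : CP 2) := fun a => by
    refine isQuotientMap_mk'.continuous.comp (Continuous.subtype_mk ?_ _)
    rcases a with _ | i
    · exact continuous_const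
    · by_cases hi : i = j
      · simp only [excCoord, hi, if_true, cross_apply]
        fun_prop
      · simp only [excCoord, hi, if_false]
        exact continuous_const
  exact Continuous.subtype_mk ((h none).prodMk (continuous_pi fun i => h (some i))) _

end

lemma cross_dot (A B P : Fin 3 → ℂ) (u v : ℂ) :
    A ⬝ᵥ (u • A + v • B) ⨯₃ P = v * (P ⬝ᵥ A ⨯₃ B) ∧
      B ⬝ᵥ (u • A + v • B) ⨯₃ P = -(u * (P ⬝ᵥ A ⨯₃ B)) := by
  constructor <;> simp [cross_apply, dotProduct, Fin.sum_univ_three] <;> ring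

variable {j : Fin r} {A B : Fin 3 → ℂ}

lemma direction_cross_ne_zero (h : (p j).rep ⬝ᵥ A ⨯₃ B ≠ 0) {u v : ℂ} (huv : u = 0 → v ≠ 0) :
    (u • A + v • B) ⨯₃ (p j).rep ≠ 0 := by
  intro h0
  obtain ⟨h1, h2⟩ := cross_dot A B (p j).rep u v
  rw [h0, dotProduct_zero] at h1 h2
  by_cases hu : u = 0
  · exact mul_ne_zero (huv hu) h h1.symm
  · exact neg_ne_zero.2 (mul_ne_zero hu h) h2.symm

lemma excPoint_mem_source (h : (p j).rep ⬝ᵥ A ⨯₃ B ≠ 0) {u v : ℂ} (hu : u ≠ 0)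
    (huv : (u • A + v • B) ⨯₃ (p j).rep ≠ 0) :
    excPoint p huv ∈ (excData p j A B h).source ∧
      (excData p j A B h).toFun (excPoint p huv) = ![0, v / u] := by
  have h' : A ⨯₃ B ⬝ᵥ (p j).rep ≠ 0 := by rwa [dotProduct_comm]
  have hj : excCoord p j (u • A + v • B) (some j) = (u • A + v • B) ⨯₃ (p j).rep := if_pos rfl
  refine ⟨⟨?_, ?_, fun i hi => ?_⟩, ?_⟩
  · rw [pt_excPoint]
    obtain ⟨c, hc, e⟩ := exists_rep_mk (excCoord_ne_zero p huv none)
    rw [e, dotProduct_smul]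
    exact mul_ne_zero hc h'
  · rw [pt_excPoint]
    obtain ⟨c, hc, e⟩ := exists_rep_mk (excCoord_ne_zero p huv (some j))
    rw [e, dotProduct_smul, hj, (cross_dot A B _ u v).2]
    exact mul_ne_zero hc (neg_ne_zero.2 (mul_ne_zero hu h))
  · rw [pt_excPoint]
    obtain ⟨c, hc, e⟩ := exists_rep_mk (excCoord_ne_zero p huv none)
    rw [e, map_smul, LinearMap.smul_apply]
    exact smul_ne_zero hc fun h0 => hi (p.injective ((eq_iff_rep _ _).2 h0)).symm
  · ext m
    fin_cases m
    · change ratio (B ⨯₃ (p j).rep) (A ⨯₃ B) ((excPoint p huv).pt none) = 0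
      rw [pt_excPoint, ratio_mk]
      change (B ⨯₃ (p j).rep ⬝ᵥ (p j).rep) / _ = (0 : ℂ)
      rw [dotProduct_comm, dot_cross_self, zero_div]
    · change ratio (-A) B ((excPoint p huv).pt (some j)) = v / u
      rw [pt_excPoint, ratio_mk, hj, neg_dotProduct, (cross_dot A B _ u v).1,
        (cross_dot A B _ u v).2, neg_div_neg_eq, mul_div_mul_right _ _ h]

/-- The change of coordinates between the two standard charts around an exceptional curve. -/
lemma excData_toFun_point (h : (p j).rep ⬝ᵥ A ⨯₃ B ≠ 0) (h' : (p j).rep ⬝ᵥ B ⨯₃ A ≠ 0)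
    (z : (excData p j A B h).target) :
    (excData p j B A h').toFun ((excData p j A B h).point z) = ![z.1 0 * z.1 1, (z.1 1)⁻¹] := by
  have hBA : (p j).rep ⬝ᵥ B ⨯₃ A = -((p j).rep ⬝ᵥ A ⨯₃ B) := by
    rw [← cross_anticomm, dotProduct_neg]
  have hL : (excData p j A B h).L none z.1 =
      (p j).rep + (z.1 0 * z.1 1) • B + z.1 0 • A := by
    change (p j).rep + z.1 0 • (A + z.1 1 • B) = _
    module
  have hLj : (excData p j A B h).L (some j) z.1 = ((1 : ℂ) • A + z.1 1 • B) ⨯₃ (p j).rep := by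
    rw [one_smul]
    exact congrFun (if_pos rfl) z.1
  ext m
  fin_cases m
  · change ratio (A ⨯₃ (p j).rep) (B ⨯₃ A) (((excData p j A B h).point z).pt none) =
      z.1 0 * z.1 1
    rw [ChartData.pt_point, ratio_mk, hL, (den_dot (p j).rep B A _ _).1,
      (den_dot (p j).rep B A _ _).2.1, mul_div_cancel_right₀ _ h']
  · change ratio (-B) A (((excData p j A B h).point z).pt (some j)) = (z.1 1)⁻¹
    rw [ChartData.pt_point, ratio_mk, hLj, neg_dotProduct, (cross_dot A B _ _ _).1,
      (cross_dot A B _ _ _).2, neg_neg, mul_div_mul_right _ _ h, one_div]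

lemma excData_chart_mem_atlas (h : (p j).rep ⬝ᵥ A ⨯₃ B ≠ 0) :
    (excData p j A B h).chart ∈ atlas (Fin 2 → ℂ) (BlowUp p) :=
  Set.mem_image_of_mem _ (Or.inr ⟨j, A, B, h, rfl⟩)

lemma hasFDerivAt_transition {z : Fin 2 → ℂ} (h1 : z 1 ≠ 0) :
    ∃ L : (Fin 2 → ℂ) →L[ℂ] (Fin 2 → ℂ),
      HasFDerivAt (fun z : Fin 2 → ℂ => ![z 0 * z 1, (z 1)⁻¹]) L z ∧ L.det = -(z 1)⁻¹ := by
  have p0 : HasFDerivAt (fun z : Fin 2 → ℂ => z 0) (ContinuousLinearMap.proj (R := ℂ) 0) z :=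
    hasFDerivAt_apply 0 z
  have p1 : HasFDerivAt (fun z : Fin 2 → ℂ => z 1) (ContinuousLinearMap.proj (R := ℂ) 1) z :=
    hasFDerivAt_apply 1 z
  have hinv := (hasDerivAt_inv h1).comp_hasFDerivAt z p1
  have hmul := p0.mul p1
  -- This is the Jacobian matrix of (z₀ z₁, 1/z₁); it is triangular, with determinant z₁ · (-1/z₁²).
  refine ⟨LinearMap.toContinuousLinearMap
    (Matrix.toLin' !![z 1, z 0; 0, -(z 1 ^ 2)⁻¹]), hasFDerivAt_pi'.2 fun m => ?_, ?_⟩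
  · fin_cases m
    · refine hmul.congr_fderiv (ContinuousLinearMap.ext fun v => ?_)
      simp [Matrix.vecHead, Matrix.vecTail]
      ring
    · refine hinv.congr_fderiv (ContinuousLinearMap.ext fun v => ?_)
      simp [Matrix.vecHead, Matrix.vecTail]
  · change LinearMap.det (Matrix.toLin' !![z 1, z 0; 0, -(z 1 ^ 2)⁻¹]) = _
    rw [LinearMap.det_toLin', Matrix.det_fin_two_of]
    field_simp
    simp

/-- The determinant of the transition function of the tangent bundle along an exceptional curve. -/
lemma det_coordChange_excPoint (h : (p j).rep ⬝ᵥ A ⨯₃ B ≠ 0) (h' : (p j).rep ⬝ᵥ B ⨯₃ A ≠ 0)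
    {u v : ℂ} (hu : u ≠ 0) (hv : v ≠ 0) (huv : (u • A + v • B) ⨯₃ (p j).rep ≠ 0) :
    ((tangentBundleCore 𝓘(ℂ, Fin 2 → ℂ) (BlowUp p)).coordChange
      ⟨_, excData_chart_mem_atlas h⟩ ⟨_, excData_chart_mem_atlas h'⟩ (excPoint p huv)).det =
      -(u / v) := by
  obtain ⟨hs, hz⟩ := excPoint_mem_source h hu huv
  set z : Fin 2 → ℂ := ![0, v / u] with hzdef
  have hzt : z ∈ (excData p j A B h).target := by
    rw [← hz]
    exact (excData p j A B h).mem_target _ hs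
  obtain ⟨L, hL, hdet⟩ := hasFDerivAt_transition (z := z) (div_ne_zero hv hu)
  have hF : HasFDerivAt ((excData p j B A h').chart ∘ (excData p j A B h).chart.symm) L z := by
    refine hL.congr_of_eventuallyEq ?_
    filter_upwards [(excData p j A B h).isOpen_target.mem_nhds hzt] with w hw
    have : (excData p j A B h).chart.symm w = (excData p j A B h).point ⟨w, hw⟩ := dif_pos hw
    rw [Function.comp_apply, this]
    exact excData_toFun_point h h' ⟨w, hw⟩
  have hcc : (tangentBundleCore 𝓘(ℂ, Fin 2 → ℂ) (BlowUp p)).coordChange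
      ⟨_, excData_chart_mem_atlas h⟩ ⟨_, excData_chart_mem_atlas h'⟩ (excPoint p huv) = L := by
    rw [tangentBundleCore_coordChange, ModelWithCorners.range_eq_univ, fderivWithin_univ]
    refine HasFDerivAt.fderiv ?_
    change HasFDerivAt ((excData p j B A h').chart ∘ (excData p j A B h).chart.symm) L
      ((excData p j A B h).toFun (excPoint p huv))
    rw [hz]
    exact hF
  rw [hcc, hdet]
  simp [hzdef]

/-- The first Chern class of a blow-up takes the value one on an exceptional curve. -/
lemma exists_sphere_evalSphere_eq_one [Nonempty (Fin r)] {c : H2 (BlowUp p)}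
    (hc : IsFirstChernClass (Fin 2 → ℂ) (BlowUp p) c) :
    ∃ (σ : SingularSimplex 2 (BlowUp p)) (x₀ : BlowUp p) (hσ : ∀ i, face i σ = .const _ x₀),
      evalSphere σ x₀ hσ c = 1 := by
  obtain ⟨j⟩ := ‹Nonempty (Fin r)›
  obtain ⟨w, hw, hw'⟩ := exists_orthogonal (p j).rep
  obtain ⟨A, B, h, -⟩ := exists_triple (p j).rep_nonzero hw hw'
  have h' : (p j).rep ⬝ᵥ B ⨯₃ A ≠ 0 := by
    rw [← cross_anticomm, dotProduct_neg]
    exact neg_ne_zero.2 h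
  have hv : ∀ t, ((bump t : ℂ) • A + triangle t • B) ⨯₃ (p j).rep ≠ 0 := fun t =>
    direction_cross_ne_zero h fun h0 => triangle_ne_zero (by exact_mod_cast h0)
  have hB : B ⨯₃ (p j).rep ≠ 0 := by
    simpa using direction_cross_ne_zero h (u := 0) (v := 1) fun _ => one_ne_zero
  -- The exceptional curve is the projective line of directions in the span of `A` and `B`, and σ is
  -- the map [bump : triangle] into it. The chart with data `A, B` covers the points with `bump`
  -- nonzero, the one with `B, A` those with `triangle` nonzero.
  let σ : SingularSimplex 2 (BlowUp p) := ⟨fun t => excPoint p (hv t), continuous_excPoint p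
    (((Complex.continuous_ofReal.comp bump.continuous).smul continuous_const).add
      (triangle.continuous.smul continuous_const)) hv⟩
  have hσ : ∀ i, face i σ = .const _ (excPoint p hB) := by
    intro i
    ext1 t
    change excPoint p (hv (stdSimplex.map i.succAbove t)) = excPoint p hB
    have h0 := bump_face i t
    have hcv : (triangle (stdSimplex.map i.succAbove t) • B) ⨯₃ (p j).rep ≠ 0 := by
      simpa [h0] using hv (stdSimplex.map i.succAbove t)
    rw [← excPoint_smul p hB hcv]
    congr 1
    simp [h0]
  refine ⟨σ, excPoint p hB, hσ, evalSphere_eq_one_of_det _ hc hσ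
    (i₁ := ⟨_, excData_chart_mem_atlas h⟩) (i₂ := ⟨_, excData_chart_mem_atlas h'⟩)
    (fun t ht => ?_) (fun t ht => ?_) fun t ht ht' => ?_⟩
  · exact (excPoint_mem_source h (by exact_mod_cast ht) (hv t)).1
  · have hv' : (triangle t • B + (bump t : ℂ) • A) ⨯₃ (p j).rep ≠ 0 := by
      rw [add_comm]
      exact hv t
    have := (excPoint_mem_source h' ht hv').1
    change excPoint p (hv t) ∈ (excData p j B A h').source
    convert this using 2
    exact add_comm _ _
  · exact det_coordChange_excPoint h h' (by exact_mod_cast ht) ht' (hv t)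

end BlowUp

end

end CircleBundle

/-! ### The circle bundle over the product -/

open CircleBundle

theorem mainTheorem7 (n : ℕ) (hn : 3 ≤ n)
    (p : Fin 8 ↪ CP 2) (hp : InGeneralPosition p)
    (c₁ : H2 (BlowUp p)) (hc₁ : IsFirstChernClass (Fin 2 → ℂ) (BlowUp p) c₁)
    (c₂ : H2 (CP 1)) (hc₂ : IsFirstChernClass (Fin 1 → ℂ) (CP 1) c₂)
    (c₃ : H2 (CP (n - 3))) (hc₃ : IsFirstChernClass (Fin (n - 3) → ℂ) (CP (n - 3)) c₃)
    (κ : H2 (BlowUp p × CP 1 × CP (n - 3)))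
    (hκ : κ = H2.map ⟨fun x => x.1, by fun_prop⟩ c₁ + H2.map ⟨fun x => x.2.1, by fun_prop⟩ c₂ +
      n • H2.map ⟨fun x => x.2.2, by fun_prop⟩ c₃)
    {P : Type*} [TopologicalSpace P] [MulAction Circle P]
    (π : P → BlowUp p × CP 1 × CP (n - 3)) (hπ : IsPrincipalCircleBundle π)
    (hE : IsEulerClass π (-κ)) :
    SimplyConnectedSpace P := by
  obtain ⟨σ, x₀, hσ, h⟩ := BlowUp.exists_sphere_evalSphere_eq_one hc₁
  let q : CP 1 × CP (n - 3) := (Classical.arbitrary _, Classical.arbitrary _)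
  -- The exceptional curve is placed in a slice. Its projections to the second and third factor are
  -- constant, so only the term with `c₁` contributes, and -κ takes the value -1.
  let ι : C(BlowUp p, BlowUp p × CP 1 × CP (n - 3)) := ⟨fun x => (x, q), by fun_prop⟩
  refine hπ.simplyConnectedSpace hE (face_comp_eq_const hσ ι) (Or.inr ?_)
  have h₁ : evalSphere (ι.comp σ) (ι x₀) (face_comp_eq_const hσ ι)
      (H2.map ⟨fun x => x.1, by fun_prop⟩ c₁) = 1 := by
    rw [evalSphere_map]
    exact h
  have h₂ : evalSphere (ι.comp σ) (ι x₀) (face_comp_eq_const hσ ι)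
      (H2.map ⟨fun x => x.2.1, by fun_prop⟩ c₂) = 0 := by
    rw [evalSphere_map]
    exact evalSphere_const q.1 c₂
  have h₃ : evalSphere (ι.comp σ) (ι x₀) (face_comp_eq_const hσ ι)
      (H2.map ⟨fun x => x.2.2, by fun_prop⟩ c₃) = 0 := by
    rw [evalSphere_map]
    exact evalSphere_const q.2 c₃
  rw [map_neg, hκ, map_add, map_add, map_nsmul, h₁, h₂, h₃]
  simp
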